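/- **Setting.** Let $Q$ be a finite-dimensional smooth Hausdorff manifold and $G$ a Lie group with Lie algebra $\mathfrak g$ acting on $Q$ on the left smoothly, freely and properly; let $\pi:Q\to Q/G$ be the quotient map, and for $\xi\in\mathfrak g$ let $\xi_Q(q)\in T_qQ$ be the derivative at $e$ of $g\mapsto g\cdot q$ applied to $\xi$. Let $(Q,L_d,\mathcal D,\mathcal D_d)$ be a nonholonomic discrete mechanical system: $L_d:Q\times Q\to\mathbb R$ is smooth, $\mathcal D\subset TQ$ is a smooth subbundle and $\mathcal D_d\subset Q\times Q$ is a submanifold. Assume that $G$ is a symmetry group, i.e. $L_d$ and $\mathcal D_d$ are invariant under the diagonal action and $\mathcal D$ under the lifted action. Put $\mathcal V^G_q=\{\xi_Q(q):\xi\in\mathfrak g\}$, $\mathcal S_q=\mathcal V^G_q\cap\mathcal D_q$, and assume that $\mathcal S$ has locally constant rank. Let $\mathfrak g^{\mathcal D}=\{(q,\xi)\in Q\times\mathfrak g:\xi_Q(q)\in\mathcal D_q\}$; its sections $\Gamma(\mathfrak g^{\mathcal D})$ are the smooth maps $\tilde\xi:Q\to\mathfrak g$ with $(q,\tilde\xi(q))\in\mathfrak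 g^{\mathcal D}$ for all $q$. **Discrete connection.** Let $\mathcal A_d$ be an affine discrete connection on $\pi$: a smooth map $\gamma:Q\to G$ with $\gamma(g\cdot q)=g\gamma(q)g^{-1}$ and a $G$-invariant submanifold $Hor\subset Q\times Q$ containing $\Gamma=\{(q,\gamma(q)\cdot q)\}$, such that each $Hor^2(q)=\{q_1:(q,q_1)\in Hor\}$ is a submanifold of $Q$ and $T_{q_1}Q=\mathcal V^G_{q_1}\oplus T_{q_1}Hor^2(q)$ for all $q_1\in (G\cdot q)\cap Hor^2(q)$. Fix a $G$-invariant open neighbourhood $U$ of $\Gamma$. Then $\mathcal A_d(q_0,q_1)\in G$ denotes the unique $g$ with $(q_0,g^{-1}\cdot q_1)\in Hor\cap U$; it is defined for those pairs $(q_0,q_1)$ for which there is exactly one such $g$. Likewise, for $r_1\in Q/G$, let $h_{q_0}(r_1)$ be the unique $q_1$ with $(q_0,q_1)\in Hor\cap U$ and $\pi(q_1)=r_1$, whenever there is exactly one, and put $\tilde F_1(q_0,w_0,r_1)=w_0\cdot h_{q_0}(r_1)$ and $\check L_d(q_0,w_0,r_1)=L_d(q_0,\tilde F_1(q_0,w_0,r_1))$.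 Let $\rho:Q\times G\to\tilde G=(Q\times G)/G$ be the quotient by the action $g\cdot(q,w)=(g\cdot q,gwg^{-1})$. **Reduced vertical equation.** Consider the points $(q_0,w_0,r_1,v_1,r_2)\in Q\times G\times (Q/G)\times\tilde G\times (Q/G)$ with $v_1$ lying over $r_1$ for which $q_1:=\tilde F_1(q_0,w_0,r_1)$ and $h_{q_1}(r_2)$ are defined, and let $w_1\in G$ be the element with $\rho(q_1,w_1)=v_1$. For $\xi_1\in\mathfrak g$ put $$\check\psi(q_0,w_0,r_1,v_1,r_2,\xi_1)=\big(D_2\check L_d(q_0,w_0,r_1)w_0^{-1}-D_2\check L_d(q_1,w_1,r_2)w_1^{-1}\big)(\xi_1),$$ where for $\alpha\in T^*_wG$ the covector $\alpha w^{-1}\in\mathfrak g^*$ is the pullback of $\alpha$ by the derivative at $e$ of right translation by $w$. The function $\check\psi$ is invariant under $g\cdot(q_0,w_0,r_1,v_1,r_2,\xi_1)=(g\cdot q_0,gw_0g^{-1},r_1,v_1,r_2,\mathrm{Ad}_g\xi_1)$ and so induces a function $\bar\psi$ on the quotient by this action, which lies over the space of the $(v_0,r_1,v_1,r_2)$ with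 $v_0=\rho(q_0,w_0)$. Let $(F_1^*\mathfrak g^{\mathcal D})/G$ be the set of the classes of the points with $(q_1,\xi_1)\in\mathfrak g^{\mathcal D}$. **Momentum.** For $\tilde\xi\in\Gamma(\mathfrak g^{\mathcal D})$ put $(J_d)_{\tilde\xi}(q_0,q_1)=J_d(q_0,q_1)(q_0,\tilde\xi(q_0))$, where $J_d:Q\times Q\to(\mathfrak g^{\mathcal D})^*$, $J_d(q_0,q_1)(q_0,\xi)=-D_1L_d(q_0,q_1)\,\xi_Q(q_0)$ for $(q_0,\xi)\in\mathfrak g^{\mathcal D}$. **Theorem.** Let $q_\cdot:\{0,\dots,N\}\to Q$ be a discrete curve with $(q_k,q_{k+1})$ in the domain of $\mathcal A_d$ for $0\le k<N$, and let $r_k=\pi(q_k)$, $w_k=\mathcal A_d(q_k,q_{k+1})$, $v_k=\rho(q_k,w_k)$. Let $S_d(q_\cdot)=\sum_{k=0}^{N-1}L_d(q_k,q_{k+1})$. The following are equivalent. 1. $dS_d(q_\cdot)(\delta q_\cdot)=0$ for all variations $\delta q_k\in\mathcal S_{q_k}$ ($0\le k\le N$) with $\delta q_0=0$ and $\delta q_N=0$.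 2. $\bar\psi|_{(F_1^*\mathfrak g^{\mathcal D})/G}=0$ along the curve: for every $1\le k\le N-1$, $\bar\psi$ vanishes at all elements of $(F_1^*\mathfrak g^{\mathcal D})/G$ lying over $(v_{k-1},r_k,v_k,r_{k+1})$. 3. For all sections $\tilde\xi\in\Gamma(\mathfrak g^{\mathcal D})$ and all $1\le k\le N-1$, $$(J_d)_{\tilde\xi}(q_k,q_{k+1})-(J_d)_{\tilde\xi}(q_{k-1},q_k)=-D_1L_d(q_{k-1},q_k)\big(\tilde\xi(q_k)-\tilde\xi(q_{k-1})\big)_Q(q_{k-1}).$$ -/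

import Mathlib

open scoped Manifold ContDiff Topology

set_option linter.unusedSectionVars false

noncomputable section

namespace DiscreteMech

/-! ### Submanifolds and subbundles -/

section Submanifolds

variable {E H M : Type*} [NormedAddCommGroup E] [NormedSpace ℝ E] [TopologicalSpace H]
  (I : ModelWithCorners ℝ E H) [TopologicalSpace M] [ChartedSpace H M]

/-- `S` is an embedded smooth submanifold of `M`: around each of its points there is a smooth chart
of `M` in which `S` is cut out by an affine subspace (slice charts). -/
def IsEmbeddedSubmanifold (S : Set M) : Prop :=
  ∀ p ∈ S, ∃ e ∈ IsManifold.maximalAtlas I ∞ M, p ∈ e.source ∧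
    ∃ F : Submodule ℝ E, ∀ x ∈ e.source, x ∈ S ↔ e.extend I x - e.extend I p ∈ F

/-- The tangent space `T_p S` of a submanifold `S` of `M`, inside `T_p M`: it is spanned by (for an
embedded submanifold: it consists of) the velocities at `p` of the smooth curves lying in `S`. -/
def tangentSpaceOf (S : Set M) (p : M) : Submodule ℝ (TangentSpace I p) :=
  Submodule.span ℝ {v | ∃ c : ℝ → M, ContMDiff 𝓘(ℝ, ℝ) I ∞ c ∧ (∀ t, c t ∈ S) ∧ c 0 = p ∧
    v = mfderiv 𝓘(ℝ, ℝ) I c 0 (1 : ℝ)}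

/-- A family of subspaces of the tangent spaces is a smooth subbundle of `TM`: locally it is spanned
by a smooth frame. -/
def IsSmoothSubbundle (D : ∀ q : M, Submodule ℝ (TangentSpace I q)) [IsManifold I 1 M] : Prop :=
  ∀ q₀ : M, ∃ W : Set M, IsOpen W ∧ q₀ ∈ W ∧
    ∃ (r : ℕ) (X : Fin r → ∀ q : M, TangentSpace I q),
      (∀ i, ContMDiffOn I I.tangent ∞ (fun q => (⟨q, X i q⟩ : TangentBundle I M)) W) ∧
      ∀ q ∈ W, LinearIndependent ℝ (fun i => X i q) ∧
        Submodule.span ℝ (Set.range fun i => X i q) = D q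

end Submanifolds

/-! ### Discrete mechanical systems -/

section Systems

/-- A nonholonomic discrete mechanical system `(Q, L_d, 𝒟, 𝒟_d)` on the manifold `Q`. -/
structure DiscreteSystem (E Q : Type*) [NormedAddCommGroup E] [NormedSpace ℝ E]
    [TopologicalSpace Q] [ChartedSpace E Q] [IsManifold 𝓘(ℝ, E) ∞ Q] where
  /-- the discrete lagrangian `L_d` -/
  L : Q × Q → ℝ
  smooth_L : ContMDiff (𝓘(ℝ, E).prod 𝓘(ℝ, E)) 𝓘(ℝ, ℝ) ∞ L
  /-- the variational constraints `𝒟 ⊆ TQ` -/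
  D : ∀ q : Q, Submodule ℝ (TangentSpace 𝓘(ℝ, E) q)
  subbundle_D : IsSmoothSubbundle 𝓘(ℝ, E) D
  /-- the discrete kinematic constraints `𝒟_d ⊆ Q × Q` -/
  Dd : Set (Q × Q)
  submanifold_Dd : IsEmbeddedSubmanifold (𝓘(ℝ, E).prod 𝓘(ℝ, E)) Dd

variable {E Q : Type*} [NormedAddCommGroup E] [NormedSpace ℝ E]
    [TopologicalSpace Q] [ChartedSpace E Q] [IsManifold 𝓘(ℝ, E) ∞ Q]

/-- `D₁ L_d (q₀, q₁)`, the derivative with respect to the first component. -/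
def DiscreteSystem.D₁L (sys : DiscreteSystem E Q) (q₀ q₁ : Q) :
    TangentSpace 𝓘(ℝ, E) q₀ →L[ℝ] ℝ :=
  mfderiv 𝓘(ℝ, E) 𝓘(ℝ, ℝ) (fun q => sys.L (q, q₁)) q₀

/-- The discrete action `S_d(q) = ∑_{k=0}^{N-1} L_d(q_k, q_{k+1})` on discrete curves
`q : {0, …, N} → Q`. -/
def DiscreteSystem.action (sys : DiscreteSystem E Q) {N : ℕ} (q : Fin (N + 1) → Q) : ℝ :=
  ∑ k : Fin N, sys.L (q k.castSucc, q k.succ)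

/-- `dS_d(q)(δq)`: the differential of the discrete action on the product manifold `Q^{N+1}`,
evaluated on a variation `δq_k ∈ T_{q_k} Q`. -/
def DiscreteSystem.dAction (sys : DiscreteSystem E Q) {N : ℕ} (q : Fin (N + 1) → Q)
    (δq : ∀ k, TangentSpace 𝓘(ℝ, E) (q k)) : ℝ :=
  (mfderiv (ModelWithCorners.pi fun _ : Fin (N + 1) => 𝓘(ℝ, E)) 𝓘(ℝ, ℝ)
    (fun c : Fin (N + 1) → Q => sys.action c) q : (Fin (N + 1) → E) →L[ℝ] ℝ) δq

end Systems

/-! ### Symmetries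

`G` is a Lie group acting on `Q` on the left; the action is smooth (`ContMDiffSMul`), free
(`IsCancelSMul`) and proper (`ProperSMul`), and `π : Q → Q/G` is the quotient map to the orbit
space. -/

section Symmetry

variable {EG G E Q : Type*} [NormedAddCommGroup EG] [NormedSpace ℝ EG]
    [TopologicalSpace G] [ChartedSpace EG G] [Group G]
    [NormedAddCommGroup E] [NormedSpace ℝ E]
    [TopologicalSpace Q] [ChartedSpace E Q] [MulAction G Q]

/-- `ξ ↦ ξ_Q(q)`, the infinitesimal generator of the action at `q`: the derivative at `1` of the
orbit map `g ↦ g • q`. -/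
def infGen (EG : Type*) {G E Q : Type*} [NormedAddCommGroup EG] [NormedSpace ℝ EG]
    [TopologicalSpace G] [ChartedSpace EG G] [Group G]
    [NormedAddCommGroup E] [NormedSpace ℝ E]
    [TopologicalSpace Q] [ChartedSpace E Q] [MulAction G Q] (q : Q) :
    GroupLieAlgebra 𝓘(ℝ, EG) G →L[ℝ] TangentSpace 𝓘(ℝ, E) q :=
  mfderiv 𝓘(ℝ, EG) 𝓘(ℝ, E) (fun g : G => g • q) 1

/-- The adjoint action `Ad_g` on the Lie algebra: the derivative at `1` of `h ↦ g h g⁻¹`. -/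
def Ad (EG : Type*) {G : Type*} [NormedAddCommGroup EG] [NormedSpace ℝ EG]
    [TopologicalSpace G] [ChartedSpace EG G] [Group G] (g : G) :
    GroupLieAlgebra 𝓘(ℝ, EG) G →L[ℝ] GroupLieAlgebra 𝓘(ℝ, EG) G :=
  mfderiv 𝓘(ℝ, EG) 𝓘(ℝ, EG) (fun h : G => g * h * g⁻¹) 1

/-- The vertical space `𝒱^G_q`, the tangent space to the orbit of `q` at `q`. -/
def verticalSpace (EG G : Type*) {E Q : Type*} [NormedAddCommGroup EG] [NormedSpace ℝ EG]
    [TopologicalSpace G] [ChartedSpace EG G] [Group G]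
    [NormedAddCommGroup E] [NormedSpace ℝ E]
    [TopologicalSpace Q] [ChartedSpace E Q] [MulAction G Q] (q : Q) :
    Submodule ℝ (TangentSpace 𝓘(ℝ, E) q) :=
  LinearMap.range (infGen EG q : GroupLieAlgebra 𝓘(ℝ, EG) G →L[ℝ] TangentSpace 𝓘(ℝ, E) q).toLinearMap

variable [IsManifold 𝓘(ℝ, E) ∞ Q]

/-- `𝒮_q = 𝒱^G_q ∩ 𝒟_q`. -/
def DiscreteSystem.S (sys : DiscreteSystem E Q) (EG G : Type*) [NormedAddCommGroup EG]
    [NormedSpace ℝ EG] [TopologicalSpace G] [ChartedSpace EG G] [Group G] [MulAction G Q] (q : Q) :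
    Submodule ℝ (TangentSpace 𝓘(ℝ, E) q) :=
  verticalSpace EG G q ⊓ sys.D q

/-- The fibre over `q` of `𝔤^𝒟 = {(q, ξ) : ξ_Q(q) ∈ 𝒟_q}`. -/
def DiscreteSystem.gD (sys : DiscreteSystem E Q) (EG G : Type*) [NormedAddCommGroup EG]
    [NormedSpace ℝ EG] [TopologicalSpace G] [ChartedSpace EG G] [Group G] [MulAction G Q] (q : Q) :
    Submodule ℝ (GroupLieAlgebra 𝓘(ℝ, EG) G) :=
  (sys.D q).comap
    (infGen EG q : GroupLieAlgebra 𝓘(ℝ, EG) G →L[ℝ] TangentSpace 𝓘(ℝ, E) q).toLinearMap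

/-- `G` is a symmetry group of the discrete mechanical system: `L_d` and `𝒟_d` are invariant under
the diagonal action and `𝒟` is invariant under the lifted action on `TQ`. -/
structure DiscreteSystem.IsSymmetric (sys : DiscreteSystem E Q) (G : Type*) [Group G]
    [MulAction G Q] : Prop where
  L_smul : ∀ (g : G) (q₀ q₁ : Q), sys.L (g • q₀, g • q₁) = sys.L (q₀, q₁)
  Dd_smul : ∀ (g : G) (q₀ q₁ : Q), (q₀, q₁) ∈ sys.Dd → (g • q₀, g • q₁) ∈ sys.Dd
  D_smul : ∀ (g : G) (q : Q), ∀ v ∈ sys.D q,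
    mfderiv 𝓘(ℝ, E) 𝓘(ℝ, E) (fun x : Q => g • x) q v ∈ sys.D (g • q)

/-- The smooth sections `Γ(𝔤^𝒟)`: smooth maps `ξ : Q → 𝔤` with `(q, ξ(q)) ∈ 𝔤^𝒟` for all `q`. -/
structure DiscreteSystem.GDSection (sys : DiscreteSystem E Q) (EG G : Type*) [NormedAddCommGroup EG]
    [NormedSpace ℝ EG] [TopologicalSpace G] [ChartedSpace EG G] [Group G] [MulAction G Q] where
  toFun : Q → GroupLieAlgebra 𝓘(ℝ, EG) G
  smooth : ContMDiff (M' := EG) 𝓘(ℝ, E) 𝓘(ℝ, EG) ∞ toFun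
  mem : ∀ q, toFun q ∈ sys.gD EG G q

/-- The nonholonomic discrete momentum map `J_d : Q × Q → (𝔤^𝒟)^*`,
`J_d(q₀, q₁)(q₀, ξ) = -D₁L_d(q₀, q₁) ξ_Q(q₀)`. -/
def DiscreteSystem.J (sys : DiscreteSystem E Q) (EG G : Type*) [NormedAddCommGroup EG]
    [NormedSpace ℝ EG] [TopologicalSpace G] [ChartedSpace EG G] [Group G] [MulAction G Q]
    (q₀ q₁ : Q) : Module.Dual ℝ (sys.gD EG G q₀) :=
  -((sys.D₁L q₀ q₁).toLinearMap ∘ₗ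
      (infGen EG q₀ : GroupLieAlgebra 𝓘(ℝ, EG) G →L[ℝ] TangentSpace 𝓘(ℝ, E) q₀).toLinearMap ∘ₗ
      (sys.gD EG G q₀).subtype)

/-- `(J_d)_ξ(q₀, q₁) = J_d(q₀, q₁)(q₀, ξ(q₀))` for a section `ξ` of `𝔤^𝒟`. -/
def DiscreteSystem.JSection (sys : DiscreteSystem E Q) (ξ : sys.GDSection EG G) (q₀ q₁ : Q) : ℝ :=
  sys.J EG G q₀ q₁ ⟨ξ.toFun q₀, ξ.mem q₀⟩

end Symmetry

/-! ### The conjugate associated bundle `(Q × G)/G` -/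

section AssociatedBundle

/-- The quotient map `π : Q → Q/G`. -/
def orbitProj (G : Type*) {Q : Type*} [Group G] [MulAction G Q] (q : Q) :
    MulAction.orbitRel.Quotient G Q :=
  Quotient.mk (MulAction.orbitRel G Q) q

/-- The product `Q × G`, carrying the action `g • (q, w) = (g • q, g w g⁻¹)`. -/
@[ext]
structure ConjPair (Q G : Type*) where
  q : Q
  w : G

variable {Q G : Type*} [Group G] [MulAction G Q]

instance : MulAction G (ConjPair Q G) where
  smul g x := ⟨g • x.q, g * x.w * g⁻¹⟩
  one_smul x := by
    ext
    · exact one_smul G x.q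
    · change 1 * x.w * 1⁻¹ = x.w
      simp
  mul_smul g h x := by
    ext
    · exact mul_smul g h x.q
    · change g * h * x.w * (g * h)⁻¹ = g * (h * x.w * h⁻¹) * g⁻¹
      group

/-- The conjugate associated bundle `G̃ = (Q × G)/G`. -/
abbrev ConjBundle (Q G : Type*) [Group G] [MulAction G Q] :=
  MulAction.orbitRel.Quotient G (ConjPair Q G)

/-- The quotient map `ρ : Q × G → G̃`. -/
def rho (q : Q) (w : G) : ConjBundle Q G :=
  Quotient.mk (MulAction.orbitRel G (ConjPair Q G)) ⟨q, w⟩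

/-- The projection `p^{Q/G} : G̃ → Q/G`, `ρ(q, w) ↦ π(q)`. -/
def ConjBundle.proj : ConjBundle Q G → MulAction.orbitRel.Quotient G Q :=
  Quotient.lift (fun x => orbitProj G x.q) (by
    rintro a b ⟨g, hg⟩
    exact Quotient.sound ⟨g, congrArg ConjPair.q hg⟩)

theorem orbitProj_eq_iff {q q' : Q} : orbitProj G q = orbitProj G q' ↔ ∃ g : G, g • q' = q :=
  ⟨fun h => Quotient.exact h, fun ⟨g, hg⟩ => Quotient.sound ⟨g, hg⟩⟩

theorem orbitProj_smul (g : G) (q : Q) : orbitProj G (g • q) = orbitProj G q :=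
  orbitProj_eq_iff.2 ⟨g, rfl⟩

/-- `τ(q, q') = g` if `g • q' = q`, for `q, q'` in the same orbit (unique if the action is free). -/
def tau (q q' : Q) (h : orbitProj G q = orbitProj G q') : G :=
  (orbitProj_eq_iff.1 h).choose

theorem tau_smul (q q' : Q) (h : orbitProj G q = orbitProj G q') : tau q q' h • q' = q :=
  (orbitProj_eq_iff.1 h).choose_spec

/-- Given `q₁ ∈ Q` and `v₁ ∈ G̃` over `π(q₁)`, the group element `τ(q₁, q̃₁) w̃₁ τ(q₁, q̃₁)⁻¹` where
`v₁ = ρ(q̃₁, w̃₁)`; it is the only `w` with `ρ(q₁, w) = v₁`. -/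
def groupCoord (q₁ : Q) (v₁ : ConjBundle Q G) (h : v₁.proj = orbitProj G q₁) : G :=
  have h' : orbitProj G q₁ = orbitProj G v₁.out.q := by
    rw [← h]
    conv_lhs => rw [← Quotient.out_eq v₁]
    rfl
  tau q₁ v₁.out.q h' * v₁.out.w * (tau q₁ v₁.out.q h')⁻¹

theorem rho_groupCoord (q₁ : Q) (v₁ : ConjBundle Q G) (h : v₁.proj = orbitProj G q₁) :
    rho q₁ (groupCoord q₁ v₁ h) = v₁ := by
  have h' : orbitProj G q₁ = orbitProj G v₁.out.q := by
    rw [← h]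
    conv_lhs => rw [← Quotient.out_eq v₁]
    rfl
  conv_rhs => rw [← Quotient.out_eq v₁]
  refine Quotient.sound ⟨tau q₁ v₁.out.q h', ?_⟩
  ext
  · exact tau_smul _ _ h'
  · rfl

theorem rho_smul (g : G) (q : Q) (w : G) : rho (g • q) (g * w * g⁻¹) = rho q w :=
  Quotient.sound ⟨g, rfl⟩

theorem rho_injective [IsCancelSMul G Q] {q : Q} {w w' : G} (h : rho q w = rho q w') : w = w' := by
  obtain ⟨g, hg⟩ := Quotient.exact h
  have h1 : g • q = q := congrArg ConjPair.q hg
  have h2 : g * w' * g⁻¹ = w := congrArg ConjPair.w hg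
  have h3 : g = 1 := IsCancelSMul.eq_one_of_smul h1
  subst h3
  simpa using h2.symm

theorem groupCoord_smul [IsCancelSMul G Q] (g : G) (q₁ : Q) (v₁ : ConjBundle Q G)
    (h : v₁.proj = orbitProj G q₁) (h' : v₁.proj = orbitProj G (g • q₁)) :
    groupCoord (g • q₁) v₁ h' = g * groupCoord q₁ v₁ h * g⁻¹ := by
  apply rho_injective (q := g • q₁)
  rw [rho_groupCoord, rho_smul, rho_groupCoord]

end AssociatedBundle

/-! ### Affine discrete connections -/

section Connections

/-- An affine discrete connection on `π : Q → Q/G`: a level `γ` and a horizontal submanifold `Hor`,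
together with an open `G`-invariant neighbourhood `U` of `Γ = {(q, γ(q) • q)}` in which the vertical /
horizontal decomposition of pairs is taken. (The associated one-form and horizontal lift are only
defined where that decomposition exists and is unique, see `domain` and `liftDomain`.) -/
structure AffineDiscreteConnection (EG G E Q : Type*) [NormedAddCommGroup EG] [NormedSpace ℝ EG]
    [TopologicalSpace G] [ChartedSpace EG G] [Group G]
    [NormedAddCommGroup E] [NormedSpace ℝ E]
    [TopologicalSpace Q] [ChartedSpace E Q] [MulAction G Q] where
  γ : Q → G
  smooth_γ : ContMDiff 𝓘(ℝ, E) 𝓘(ℝ, EG) ∞ γ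
  γ_smul : ∀ (g : G) (q : Q), γ (g • q) = g * γ q * g⁻¹
  Hor : Set (Q × Q)
  submanifold_Hor : IsEmbeddedSubmanifold (𝓘(ℝ, E).prod 𝓘(ℝ, E)) Hor
  Hor_smul : ∀ (g : G) (q₀ q₁ : Q), (q₀, q₁) ∈ Hor → (g • q₀, g • q₁) ∈ Hor
  level_mem_Hor : ∀ q : Q, (q, γ q • q) ∈ Hor
  submanifold_Hor₂ : ∀ q : Q, IsEmbeddedSubmanifold 𝓘(ℝ, E) {q₁ : Q | (q, q₁) ∈ Hor}
  transversal : ∀ q q₁ : Q, q₁ ∈ MulAction.orbit G q → (q, q₁) ∈ Hor →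
    IsCompl (verticalSpace EG G q₁) (tangentSpaceOf 𝓘(ℝ, E) {q₁ : Q | (q, q₁) ∈ Hor} q₁)
  U : Set (Q × Q)
  isOpen_U : IsOpen U
  U_smul : ∀ (g : G) (q₀ q₁ : Q), (q₀, q₁) ∈ U → (g • q₀, g • q₁) ∈ U
  level_mem_U : ∀ q : Q, (q, γ q • q) ∈ U

variable {EG G E Q : Type*} [NormedAddCommGroup EG] [NormedSpace ℝ EG]
    [TopologicalSpace G] [ChartedSpace EG G] [Group G]
    [NormedAddCommGroup E] [NormedSpace ℝ E]
    [TopologicalSpace Q] [ChartedSpace E Q] [MulAction G Q]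

namespace AffineDiscreteConnection

variable (A : AffineDiscreteConnection EG G E Q)

/-- The pairs `(q₀, q₁)` for which there is a unique `g` with
`(q₀, q₁) = (q₀, g • q₀) · (q₀, g⁻¹ • q₁)` and `(q₀, g⁻¹ • q₁) ∈ Hor ∩ U`. -/
def domain : Set (Q × Q) :=
  {p | ∃! g : G, (p.1, g⁻¹ • p.2) ∈ A.Hor ∩ A.U}

/-- The discrete connection one-form `𝒜_d : Q × Q → G` (on its domain). -/
def form (q₀ q₁ : Q) (h : (q₀, q₁) ∈ A.domain) : G :=
  h.exists.choose

/-- The domain of the discrete horizontal lift. -/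
def liftDomain : Set (Q × MulAction.orbitRel.Quotient G Q) :=
  {p | ∃! q₁ : Q, (p.1, q₁) ∈ A.Hor ∩ A.U ∧ orbitProj G q₁ = p.2}

/-- The second component of the discrete horizontal lift: the unique `q₁` with `(q₀, q₁)`
horizontal and `π(q₁) = r₁`. -/
def hlift (q₀ : Q) (r₁ : MulAction.orbitRel.Quotient G Q) (h : (q₀, r₁) ∈ A.liftDomain) : Q :=
  h.exists.choose

/-- `F̃₁(q₀, w₀, r₁) = w₀ • (second component of the horizontal lift of r₁ at q₀)`. -/
def F₁ (q₀ : Q) (w₀ : G) (r₁ : MulAction.orbitRel.Quotient G Q) (h : (q₀, r₁) ∈ A.liftDomain) : Q :=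
  w₀ • A.hlift q₀ r₁ h

theorem hlift_spec (q₀ : Q) (r₁ : MulAction.orbitRel.Quotient G Q)
    (h : (q₀, r₁) ∈ A.liftDomain) :
    (q₀, A.hlift q₀ r₁ h) ∈ A.Hor ∩ A.U ∧ orbitProj G (A.hlift q₀ r₁ h) = r₁ :=
  h.exists.choose_spec

theorem horU_smul {g : G} {q₀ q₁ : Q} (h : (q₀, q₁) ∈ A.Hor ∩ A.U) :
    (g • q₀, g • q₁) ∈ A.Hor ∩ A.U :=
  ⟨A.Hor_smul g _ _ h.1, A.U_smul g _ _ h.2⟩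

theorem liftDomain_smul (g : G) {q₀ : Q} {r₁ : MulAction.orbitRel.Quotient G Q}
    (h : (q₀, r₁) ∈ A.liftDomain) : (g • q₀, r₁) ∈ A.liftDomain := by
  obtain ⟨q₁, ⟨h1, h2⟩, h3⟩ := h
  refine ⟨g • q₁, ⟨A.horU_smul h1, by rw [orbitProj_smul]; exact h2⟩, ?_⟩
  rintro y ⟨hy1, hy2⟩
  have := h3 (g⁻¹ • y) ⟨by simpa using A.horU_smul (g := g⁻¹) hy1, by rw [orbitProj_smul]; exact hy2⟩
  rw [← this, smul_inv_smul]

theorem hlift_smul (g : G) {q₀ : Q} {r₁ : MulAction.orbitRel.Quotient G Q}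
    (h : (q₀, r₁) ∈ A.liftDomain) (h' : (g • q₀, r₁) ∈ A.liftDomain) :
    A.hlift (g • q₀) r₁ h' = g • A.hlift q₀ r₁ h := by
  refine (ExistsUnique.unique h' (A.hlift_spec _ _ h') ⟨A.horU_smul (A.hlift_spec _ _ h).1, ?_⟩)
  rw [orbitProj_smul]
  exact (A.hlift_spec _ _ h).2

theorem F₁_smul (g : G) {q₀ : Q} (w₀ : G) {r₁ : MulAction.orbitRel.Quotient G Q}
    (h : (q₀, r₁) ∈ A.liftDomain) (h' : (g • q₀, r₁) ∈ A.liftDomain) :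
    A.F₁ (g • q₀) (g * w₀ * g⁻¹) r₁ h' = g • A.F₁ q₀ w₀ r₁ h := by
  simp only [F₁, A.hlift_smul g h h', smul_smul]
  congr 1
  group

theorem orbitProj_F₁ (q₀ : Q) (w₀ : G) (r₁ : MulAction.orbitRel.Quotient G Q)
    (h : (q₀, r₁) ∈ A.liftDomain) : orbitProj G (A.F₁ q₀ w₀ r₁ h) = r₁ := by
  rw [F₁, orbitProj_smul]
  exact (A.hlift_spec _ _ h).2

end AffineDiscreteConnection

end Connections

/-! ### The reduced vertical equation -/

section VerticalEquation

variable {EG G E Q : Type*} [NormedAddCommGroup EG] [NormedSpace ℝ EG]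
    [TopologicalSpace G] [ChartedSpace EG G] [Group G]
    [NormedAddCommGroup E] [NormedSpace ℝ E]
    [TopologicalSpace Q] [ChartedSpace E Q] [IsManifold 𝓘(ℝ, E) ∞ Q] [MulAction G Q]

/-- `Ľ_d(q₀, w₀, r₁) = L_d(q₀, F̃₁(q₀, w₀, r₁))`. -/
def Lcheck (sys : DiscreteSystem E Q) (A : AffineDiscreteConnection EG G E Q)
    (q₀ : Q) (w₀ : G) (r₁ : MulAction.orbitRel.Quotient G Q) (h : (q₀, r₁) ∈ A.liftDomain) : ℝ :=
  sys.L (q₀, A.F₁ q₀ w₀ r₁ h)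

/-- `D₂Ľ_d(q₀, w₀, r₁) ∈ T^*_{w₀} G`. -/
def D₂Lcheck (sys : DiscreteSystem E Q) (A : AffineDiscreteConnection EG G E Q)
    (q₀ : Q) (w₀ : G) (r₁ : MulAction.orbitRel.Quotient G Q) (h : (q₀, r₁) ∈ A.liftDomain) :
    TangentSpace 𝓘(ℝ, EG) w₀ →L[ℝ] ℝ :=
  mfderiv 𝓘(ℝ, EG) 𝓘(ℝ, ℝ) (fun w => Lcheck sys A q₀ w r₁ h) w₀

/-- `α w⁻¹ ∈ 𝔤^*` for `α ∈ T^*_w G`: the pullback of `α` by the derivative at `1` of the right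
translation by `w`. -/
def translateToOne {w : G} (α : TangentSpace 𝓘(ℝ, EG) w →L[ℝ] ℝ) :
    GroupLieAlgebra 𝓘(ℝ, EG) G →L[ℝ] ℝ :=
  α.comp (mfderiv 𝓘(ℝ, EG) 𝓘(ℝ, EG) (fun s : G => s * w) 1 :
    GroupLieAlgebra 𝓘(ℝ, EG) G →L[ℝ] TangentSpace 𝓘(ℝ, EG) w)

/-- The points `(q₀, w₀, r₁, v₁, r₂)` of `Q̌^{(2)}_G = Q × G × (Q/G) ×_{Q/G} G̃ × (Q/G)` (with the
horizontal lifts of `r₁` at `q₀` and of `r₂` at `q₁ = F̃₁(q₀, w₀, r₁)` defined) together with an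
element `ξ₁` of `𝔤`, i.e. the points of the trivial bundle `Q̌^{(2)}_G × 𝔤 = F₁^*(Q × 𝔤)`. -/
@[ext]
structure VertPoint (A : AffineDiscreteConnection EG G E Q) where
  q₀ : Q
  w₀ : G
  r₁ : MulAction.orbitRel.Quotient G Q
  v₁ : ConjBundle Q G
  r₂ : MulAction.orbitRel.Quotient G Q
  ξ₁ : GroupLieAlgebra 𝓘(ℝ, EG) G
  fib : v₁.proj = r₁
  dom₁ : (q₀, r₁) ∈ A.liftDomain
  dom₂ : (A.F₁ q₀ w₀ r₁ dom₁, r₂) ∈ A.liftDomain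

variable {A : AffineDiscreteConnection EG G E Q}

/-- `q₁ = F₁(q₀, w₀, r₁, v₁, r₂) = F̃₁(q₀, w₀, r₁)`. -/
def VertPoint.q₁ (x : VertPoint A) : Q :=
  A.F₁ x.q₀ x.w₀ x.r₁ x.dom₁

theorem VertPoint.proj_v₁ (x : VertPoint A) : x.v₁.proj = orbitProj G x.q₁ := by
  rw [VertPoint.q₁, A.orbitProj_F₁]
  exact x.fib

/-- `w₁ = F₂(q₀, w₀, r₁, v₁, r₂)`. -/
def VertPoint.w₁ (x : VertPoint A) : G :=
  groupCoord x.q₁ x.v₁ x.proj_v₁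

/-- `ψ̌(q₀, w₀, r₁, v₁, r₂, ξ₁) =
(D₂Ľ_d(q₀, w₀, r₁) w₀⁻¹ - D₂Ľ_d(q₁, w₁, r₂) w₁⁻¹)(ξ₁)`. -/
def psiCheck (sys : DiscreteSystem E Q) (x : VertPoint A) : ℝ :=
  (translateToOne (D₂Lcheck sys A x.q₀ x.w₀ x.r₁ x.dom₁) -
    translateToOne (D₂Lcheck sys A x.q₁ x.w₁ x.r₂ x.dom₂)) x.ξ₁

theorem Ad_one [IsManifold 𝓘(ℝ, EG) ∞ G] (ξ : GroupLieAlgebra 𝓘(ℝ, EG) G) : Ad EG (1 : G) ξ = ξ := by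
  have : (fun h : G => 1 * h * 1⁻¹) = id := by
    funext h
    simp
  rw [Ad, this, mfderiv_id]
  rfl

theorem mdiff_conj [LieGroup 𝓘(ℝ, EG) ∞ G] (g x : G) :
    MDifferentiableAt 𝓘(ℝ, EG) 𝓘(ℝ, EG) (fun h : G => g * h * g⁻¹) x := by
  have h : ContMDiff 𝓘(ℝ, EG) 𝓘(ℝ, EG) ∞ (fun h : G => g * h * g⁻¹) :=
    (contMDiff_const.mul contMDiff_id).mul contMDiff_const
  exact h.mdifferentiableAt (by simp)

theorem Ad_mul [LieGroup 𝓘(ℝ, EG) ∞ G] (g h : G) (ξ : GroupLieAlgebra 𝓘(ℝ, EG) G) :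
    Ad EG (g * h) ξ = Ad EG g (Ad EG h ξ) := by
  have e : (fun x : G => g * h * x * (g * h)⁻¹) =
      (fun x : G => g * x * g⁻¹) ∘ (fun x : G => h * x * h⁻¹) := by
    funext x
    simp [mul_assoc]
  have h1 : h * 1 * h⁻¹ = 1 := by simp
  have key := mfderiv_comp_apply_of_eq (I := 𝓘(ℝ, EG)) (I' := 𝓘(ℝ, EG)) (I'' := 𝓘(ℝ, EG)) _
    (mdiff_conj (EG := EG) g (1 : G)) (mdiff_conj (EG := EG) h (1 : G)) h1 ξ
  rw [← e] at key
  exact key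

/-- The action `g • (q₀, w₀, r₁, v₁, r₂, ξ₁) = (g • q₀, g w₀ g⁻¹, r₁, v₁, r₂, Ad_g ξ₁)`. -/
instance [LieGroup 𝓘(ℝ, EG) ∞ G] : MulAction G (VertPoint A) where
  smul g x :=
    { q₀ := g • x.q₀
      w₀ := g * x.w₀ * g⁻¹
      r₁ := x.r₁
      v₁ := x.v₁
      r₂ := x.r₂
      ξ₁ := Ad EG g x.ξ₁
      fib := x.fib
      dom₁ := A.liftDomain_smul g x.dom₁
      dom₂ := by
        rw [A.F₁_smul g x.w₀ x.dom₁]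
        exact A.liftDomain_smul g x.dom₂ }
  one_smul x := by
    ext1
    · exact one_smul G x.q₀
    · change 1 * x.w₀ * 1⁻¹ = x.w₀
      simp
    · rfl
    · rfl
    · rfl
    · exact Ad_one x.ξ₁
  mul_smul g h x := by
    ext1
    · exact mul_smul g h x.q₀
    · change g * h * x.w₀ * (g * h)⁻¹ = g * (h * x.w₀ * h⁻¹) * g⁻¹
      group
    · rfl
    · rfl
    · rfl
    · exact Ad_mul g h x.ξ₁

theorem VertPoint.smul_q₁ [LieGroup 𝓘(ℝ, EG) ∞ G] (g : G) (x : VertPoint A) :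
    (g • x).q₁ = g • x.q₁ :=
  A.F₁_smul g x.w₀ x.dom₁ _

theorem VertPoint.smul_w₁ [LieGroup 𝓘(ℝ, EG) ∞ G] [IsCancelSMul G Q] (g : G) (x : VertPoint A) :
    (g • x).w₁ = g * x.w₁ * g⁻¹ := by
  have h : ∀ (y : Q) (hy : x.v₁.proj = orbitProj G y), y = g • x.q₁ →
      groupCoord y x.v₁ hy = g * groupCoord x.q₁ x.v₁ x.proj_v₁ * g⁻¹ := by
    rintro y hy rfl
    exact groupCoord_smul g x.q₁ x.v₁ x.proj_v₁ hy
  exact h _ (g • x).proj_v₁ (x.smul_q₁ g)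

variable [LieGroup 𝓘(ℝ, EG) ∞ G] [ContMDiffSMul 𝓘(ℝ, EG) 𝓘(ℝ, E) ∞ G Q]

theorem contMDiff_Lcheck (sys : DiscreteSystem E Q) (q₀ : Q)
    (r₁ : MulAction.orbitRel.Quotient G Q) (h : (q₀, r₁) ∈ A.liftDomain) :
    ContMDiff 𝓘(ℝ, EG) 𝓘(ℝ, ℝ) ∞ (fun w => Lcheck sys A q₀ w r₁ h) := by
  have h1 : ContMDiff 𝓘(ℝ, EG) 𝓘(ℝ, E) ∞ (fun w : G => w • A.hlift q₀ r₁ h) :=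
    (contMDiff_smul (I := 𝓘(ℝ, EG)) (I' := 𝓘(ℝ, E)) (n := ∞) (G := G) (M := Q)).comp
      (contMDiff_id.prodMk contMDiff_const)
  exact sys.smooth_L.comp (contMDiff_const.prodMk h1)

theorem translateToOne_D₂Lcheck (sys : DiscreteSystem E Q) (q₀ : Q) (w : G)
    (r₁ : MulAction.orbitRel.Quotient G Q) (h : (q₀, r₁) ∈ A.liftDomain)
    (ξ : GroupLieAlgebra 𝓘(ℝ, EG) G) :
    translateToOne (D₂Lcheck sys A q₀ w r₁ h) ξ =
      mfderiv 𝓘(ℝ, EG) 𝓘(ℝ, ℝ) (fun s : G => Lcheck sys A q₀ (s * w) r₁ h) 1 ξ := by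
  have hR : ContMDiff 𝓘(ℝ, EG) 𝓘(ℝ, EG) ∞ (fun s : G => s * w) :=
    contMDiff_id.mul contMDiff_const
  exact (mfderiv_comp_apply_of_eq (I := 𝓘(ℝ, EG)) (I' := 𝓘(ℝ, EG)) (I'' := 𝓘(ℝ, ℝ)) _
    ((contMDiff_Lcheck sys q₀ r₁ h).mdifferentiableAt (by simp) (x := w))
    (hR.mdifferentiableAt (by simp) (x := (1 : G))) (one_mul w) ξ).symm

theorem translateToOne_smul {sys : DiscreteSystem E Q} (hsys : sys.IsSymmetric G) (g : G) {q₀ : Q}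
    (w : G) {r₁ : MulAction.orbitRel.Quotient G Q} (h : (q₀, r₁) ∈ A.liftDomain)
    (h' : (g • q₀, r₁) ∈ A.liftDomain) (ξ : GroupLieAlgebra 𝓘(ℝ, EG) G) :
    translateToOne (D₂Lcheck sys A (g • q₀) (g * w * g⁻¹) r₁ h') (Ad EG g ξ) =
      translateToOne (D₂Lcheck sys A q₀ w r₁ h) ξ := by
  rw [translateToOne_D₂Lcheck, translateToOne_D₂Lcheck]
  have hR : ContMDiff 𝓘(ℝ, EG) 𝓘(ℝ, EG) ∞ (fun s : G => s * (g * w * g⁻¹)) :=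
    contMDiff_id.mul contMDiff_const
  have h1 : g * 1 * g⁻¹ = 1 := by simp
  have key := mfderiv_comp_apply_of_eq (I := 𝓘(ℝ, EG)) (I' := 𝓘(ℝ, EG)) (I'' := 𝓘(ℝ, ℝ)) _
    (((contMDiff_Lcheck sys (g • q₀) r₁ h').comp hR).mdifferentiableAt (by simp) (x := (1 : G)))
    (mdiff_conj (EG := EG) g (1 : G)) h1 ξ
  have e : ((fun w => Lcheck sys A (g • q₀) w r₁ h') ∘ fun s : G => s * (g * w * g⁻¹)) ∘
      (fun s : G => g * s * g⁻¹) = fun s => Lcheck sys A q₀ (s * w) r₁ h := by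
    funext s
    have : g * s * g⁻¹ * (g * w * g⁻¹) = g * (s * w) * g⁻¹ := by group
    simp only [Function.comp, this, Lcheck, A.F₁_smul g (s * w) h h', hsys.L_smul]
  rw [e] at key
  exact key.symm

theorem psiCheck_smul [IsCancelSMul G Q] {sys : DiscreteSystem E Q} (hsys : sys.IsSymmetric G)
    (g : G) (x : VertPoint A) : psiCheck sys (g • x) = psiCheck sys x := by
  have h1 : translateToOne (D₂Lcheck sys A (g • x).q₀ (g • x).w₀ (g • x).r₁ (g • x).dom₁)
      (g • x).ξ₁ = translateToOne (D₂Lcheck sys A x.q₀ x.w₀ x.r₁ x.dom₁) x.ξ₁ :=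
    translateToOne_smul hsys g x.w₀ x.dom₁ _ x.ξ₁
  have h2' : ∀ (y : Q) (w : G) (hy : (y, x.r₂) ∈ A.liftDomain), y = g • x.q₁ →
      w = g * x.w₁ * g⁻¹ → translateToOne (D₂Lcheck sys A y w x.r₂ hy) (Ad EG g x.ξ₁) =
        translateToOne (D₂Lcheck sys A x.q₁ x.w₁ x.r₂ x.dom₂) x.ξ₁ := by
    rintro y w hy rfl rfl
    exact translateToOne_smul hsys g x.w₁ x.dom₂ hy x.ξ₁
  have h2 : translateToOne (D₂Lcheck sys A (g • x).q₁ (g • x).w₁ (g • x).r₂ (g • x).dom₂)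
      (g • x).ξ₁ = translateToOne (D₂Lcheck sys A x.q₁ x.w₁ x.r₂ x.dom₂) x.ξ₁ :=
    h2' _ _ (g • x).dom₂ (x.smul_q₁ g) (x.smul_w₁ g)
  unfold psiCheck
  rw [sub_apply, sub_apply, h1, h2]

/-- The bundle `(Q̌^{(2)}_G × 𝔤)/G`. -/
abbrev VertBundle (A : AffineDiscreteConnection EG G E Q) :=
  MulAction.orbitRel.Quotient G (VertPoint A)

/-- The projection of `(Q̌^{(2)}_G × 𝔤)/G` onto (the domain in)
`Q^{(2)}_G = (G̃ × (Q/G)) ×_{Q/G} (G̃ × (Q/G))`, `[(q₀, w₀, r₁, v₁, r₂, ξ₁)] ↦ (ρ(q₀, w₀), r₁, v₁, r₂)`. -/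
def VertBundle.base : VertBundle A → ConjBundle Q G × MulAction.orbitRel.Quotient G Q ×
    ConjBundle Q G × MulAction.orbitRel.Quotient G Q :=
  Quotient.lift (fun x => (rho x.q₀ x.w₀, x.r₁, x.v₁, x.r₂)) (by
    rintro _ b ⟨g, rfl⟩
    exact Prod.ext (rho_smul g b.q₀ b.w₀) rfl)

/-- `ψ̄ : (Q̌^{(2)}_G × 𝔤)/G → ℝ`, the map induced by `ψ̌`. -/
def psiBar [IsCancelSMul G Q] (sys : DiscreteSystem E Q) (hsys : sys.IsSymmetric G) :
    VertBundle A → ℝ :=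
  Quotient.lift (fun x => psiCheck sys x) (by
    rintro _ b ⟨g, rfl⟩
    exact psiCheck_smul hsys g b)

/-- The subbundle `(F₁^* 𝔤^𝒟)/G` of `(Q̌^{(2)}_G × 𝔤)/G`: the classes of the points with
`(q₁, ξ₁) ∈ 𝔤^𝒟`. -/
def gDBundle (sys : DiscreteSystem E Q) (A : AffineDiscreteConnection EG G E Q) :
    Set (VertBundle A) :=
  Quotient.mk (MulAction.orbitRel G (VertPoint A)) '' {x | x.ξ₁ ∈ sys.gD EG G x.q₁}

end VerticalEquation

end DiscreteMech
end

open DiscreteMech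

/-! All three conditions say the same thing about consecutive points `a`, `b`, `c` of the curve:
`D₂L(a,b) ξ_Q(b) + D₁L(b,c) ξ_Q(b) = 0` for every `ξ` in the fibre of `𝔤^𝒟` over `b`.

Condition 1: `dS_d` is a sum over edges. Regrouped by vertices with fixed ends, it couples each
interior `δq_k` only to its two neighbours. The `δq_k` are independent, and `𝒮_q` is the image of
the fibre of `𝔤^𝒟` under `ξ ↦ ξ_Q(q)` (`dAction_eq_zero_iff`).

Condition 2: replacing `w` by `s w` moves the end point `q₁` to `s • q₁`, so the translated
covectors in `ψ̌` are derivatives of `L_d` along orbits. Differentiating the invariance of `L_d`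
(`D₁L_add_D₂L_infGen`) turns the second one into a `D₁L` term at `q₁`. The discrete connection
recovers the curve from its reduced data up to `G` (`psiBar_eq_zero_iff`).

Condition 3: the same infinitesimal invariance turns the momentum equation of a section into the
vertical equation at the value of the section at `b` (`JSection_sub_eq_iff`). The converse needs
every element of `𝔤^𝒟` to be a value of a global smooth section (`exists_gDSection`). The action
being free, generators are injective, so `𝔤^𝒟` has the locally constant rank of `𝒮`. It is then
locally a kernel of constant dimension, in which vectors extend smoothly, and a bump function makes
the extension global. -/

noncomputable section

namespace DiscreteMech

/-! ### Evaluation maps on finite powers of a manifold -/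

section PowerManifold

open Set

variable {ι E M : Type*} [Fintype ι] [NormedAddCommGroup E] [NormedSpace ℝ E]
  [TopologicalSpace M] [ChartedSpace E M]

/-- Read in the product chart, evaluation at `k` is the `k`-th coordinate projection. -/
theorem hasMFDerivAt_eval (q : ι → M) (k : ι) :
    HasMFDerivAt (ModelWithCorners.pi fun _ : ι => 𝓘(ℝ, E)) 𝓘(ℝ, E) (fun c : ι → M => c k) q
      (ContinuousLinearMap.proj k : (ι → E) →L[ℝ] E) := by
  refine ⟨(continuous_apply k).continuousAt, ?_⟩
  have hp : HasFDerivAt (fun y : ι → E => y k) (ContinuousLinearMap.proj k : (ι → E) →L[ℝ] E)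
      (extChartAt (ModelWithCorners.pi fun _ : ι => 𝓘(ℝ, E)) q q) :=
    (ContinuousLinearMap.proj k : (ι → E) →L[ℝ] E).hasFDerivAt
  refine (hp.congr_of_eventuallyEq ?_).hasFDerivWithinAt
  -- The chart reading is the projection only where the `k`-th coordinate lies in the chart target,
  -- which suffices for the germ.
  have ht : (fun y : ι → E => y k) ⁻¹' (chartAt E (q k)).target ∈
      𝓝 (extChartAt (ModelWithCorners.pi fun _ : ι => 𝓘(ℝ, E)) q q) :=
    (continuous_apply k).continuousAt.preimage_mem_nhds
      ((chartAt E (q k)).open_target.mem_nhds (mem_chart_target E (q k)))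
  filter_upwards [ht] with y hy
  exact (chartAt E (q k)).right_inv hy

end PowerManifold

/-! ### The differential of the discrete action -/

section Action

variable {E Q : Type*} [NormedAddCommGroup E] [NormedSpace ℝ E]
    [TopologicalSpace Q] [ChartedSpace E Q] [IsManifold 𝓘(ℝ, E) ∞ Q]

/-- `D₂ L_d (q₀, q₁)`, the derivative with respect to the second component. -/
def DiscreteSystem.D₂L (sys : DiscreteSystem E Q) (q₀ q₁ : Q) :
    TangentSpace 𝓘(ℝ, E) q₁ →L[ℝ] ℝ :=
  mfderiv 𝓘(ℝ, E) 𝓘(ℝ, ℝ) (fun q => sys.L (q₀, q)) q₁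

variable (sys : DiscreteSystem E Q)

theorem DiscreteSystem.mdifferentiableAt_L (p : Q × Q) :
    MDifferentiableAt (𝓘(ℝ, E).prod 𝓘(ℝ, E)) 𝓘(ℝ, ℝ) sys.L p :=
  sys.smooth_L.mdifferentiableAt (by simp)

theorem DiscreteSystem.mfderiv_L_apply (p : Q × Q)
    (v : TangentSpace (𝓘(ℝ, E).prod 𝓘(ℝ, E)) p) :
    mfderiv (𝓘(ℝ, E).prod 𝓘(ℝ, E)) 𝓘(ℝ, ℝ) sys.L p v =
      sys.D₁L p.1 p.2 v.1 + sys.D₂L p.1 p.2 v.2 :=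
  mfderiv_prod_eq_add_apply (sys.mdifferentiableAt_L p)

/-- Each summand of the action is `L_d` composed with a pair of evaluations, so the chain rule
applies edge by edge. -/
theorem DiscreteSystem.dAction_eq_sum {N : ℕ} (q : Fin (N + 1) → Q)
    (δq : ∀ k, TangentSpace 𝓘(ℝ, E) (q k)) :
    sys.dAction q δq = ∑ k : Fin N, (sys.D₁L (q k.castSucc) (q k.succ) (δq k.castSucc) +
      sys.D₂L (q k.castSucc) (q k.succ) (δq k.succ)) := by
  let D : Fin N → (Fin (N + 1) → E) →L[ℝ] ℝ := fun k =>
    (mfderiv (𝓘(ℝ, E).prod 𝓘(ℝ, E)) 𝓘(ℝ, ℝ) sys.L (q k.castSucc, q k.succ) :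
        E × E →L[ℝ] ℝ).comp
      ((ContinuousLinearMap.proj k.castSucc : (Fin (N + 1) → E) →L[ℝ] E).prod
        (ContinuousLinearMap.proj k.succ : (Fin (N + 1) → E) →L[ℝ] E))
  have hk : ∀ k : Fin N, HasMFDerivAt (ModelWithCorners.pi fun _ : Fin (N + 1) => 𝓘(ℝ, E))
      𝓘(ℝ, ℝ) (fun c : Fin (N + 1) → Q => sys.L (c k.castSucc, c k.succ)) q (D k) := fun k =>
    HasMFDerivAt.comp q (sys.mdifferentiableAt_L (q k.castSucc, q k.succ)).hasMFDerivAt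
      ((hasMFDerivAt_eval q k.castSucc).prodMk (hasMFDerivAt_eval q k.succ))
  have hsum : HasMFDerivAt (ModelWithCorners.pi fun _ : Fin (N + 1) => 𝓘(ℝ, E)) 𝓘(ℝ, ℝ)
      (∑ k : Fin N, fun c : Fin (N + 1) → Q => sys.L (c k.castSucc, c k.succ)) q
      (∑ k : Fin N, D k) := HasMFDerivAt.sum fun k _ => hk k
  have e : (fun c : Fin (N + 1) → Q => sys.action c) =
      ∑ k : Fin N, fun c : Fin (N + 1) → Q => sys.L (c k.castSucc, c k.succ) := by
    funext c
    simp [DiscreteSystem.action]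
  rw [DiscreteSystem.dAction, e, hsum.mfderiv]
  refine (sum_apply Finset.univ D (δq : Fin (N + 1) → E)).trans
    (Finset.sum_congr rfl fun k _ => ?_)
  exact sys.mfderiv_L_apply (q k.castSucc, q k.succ) (δq k.castSucc, δq k.succ)

end Action

/-! ### Infinitesimal generators -/

section Generators

variable {EG G E Q : Type*} [NormedAddCommGroup EG] [NormedSpace ℝ EG]
    [TopologicalSpace G] [ChartedSpace EG G] [Group G]
    [NormedAddCommGroup E] [NormedSpace ℝ E]
    [TopologicalSpace Q] [ChartedSpace E Q] [MulAction G Q]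

theorem contMDiff_orbitMap [ContMDiffSMul 𝓘(ℝ, EG) 𝓘(ℝ, E) ∞ G Q] (q : Q) :
    ContMDiff 𝓘(ℝ, EG) 𝓘(ℝ, E) ∞ (fun g : G => g • q) :=
  (contMDiff_smul (I := 𝓘(ℝ, EG)) (I' := 𝓘(ℝ, E)) (n := ∞) (G := G) (M := Q)).comp
    (contMDiff_id.prodMk contMDiff_const)

theorem contMDiff_smul_left [ContMDiffSMul 𝓘(ℝ, EG) 𝓘(ℝ, E) ∞ G Q] (g : G) :
    ContMDiff 𝓘(ℝ, E) 𝓘(ℝ, E) ∞ (fun q : Q => g • q) :=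
  (contMDiff_smul (I := 𝓘(ℝ, EG)) (I' := 𝓘(ℝ, E)) (n := ∞) (G := G) (M := Q)).comp
    (contMDiff_const.prodMk contMDiff_id)

theorem hasMFDerivAt_orbitMap [ContMDiffSMul 𝓘(ℝ, EG) 𝓘(ℝ, E) ∞ G Q] (q : Q) :
    HasMFDerivAt 𝓘(ℝ, EG) 𝓘(ℝ, E) (fun g : G => g • q) 1 (infGen (E := E) EG q : EG →L[ℝ] E) :=
  ((contMDiff_orbitMap q).mdifferentiableAt (by simp)).hasMFDerivAt

variable [IsManifold 𝓘(ℝ, E) ∞ Q]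

/-- The derivative at `1` of `g ↦ L_d(q₀, g • q₁)`. -/
theorem DiscreteSystem.D₂L_infGen [ContMDiffSMul 𝓘(ℝ, EG) 𝓘(ℝ, E) ∞ G Q]
    (sys : DiscreteSystem E Q) (q₀ q₁ : Q) (ξ : GroupLieAlgebra 𝓘(ℝ, EG) G) :
    mfderiv 𝓘(ℝ, EG) 𝓘(ℝ, ℝ) (fun g : G => sys.L (q₀, g • q₁)) 1 ξ =
      sys.D₂L q₀ q₁ (infGen EG q₁ ξ) := by
  have h2 : MDifferentiableAt 𝓘(ℝ, E) 𝓘(ℝ, ℝ) (fun q : Q => sys.L (q₀, q)) q₁ :=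
    (sys.smooth_L.comp (contMDiff_const.prodMk contMDiff_id)).mdifferentiableAt (by simp)
  exact mfderiv_comp_apply_of_eq (I := 𝓘(ℝ, EG)) (I' := 𝓘(ℝ, E)) (I'' := 𝓘(ℝ, ℝ)) _ h2
    ((contMDiff_orbitMap q₁).mdifferentiableAt (by simp) (x := (1 : G))) (one_smul G q₁) ξ

/-- The infinitesimal form of the invariance of `L_d` under the diagonal action. -/
theorem DiscreteSystem.IsSymmetric.D₁L_add_D₂L_infGen [ContMDiffSMul 𝓘(ℝ, EG) 𝓘(ℝ, E) ∞ G Q]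
    {sys : DiscreteSystem E Q} (hsys : sys.IsSymmetric G) (q₀ q₁ : Q)
    (ξ : GroupLieAlgebra 𝓘(ℝ, EG) G) :
    sys.D₁L q₀ q₁ (infGen EG q₀ ξ) + sys.D₂L q₀ q₁ (infGen EG q₁ ξ) = 0 := by
  have hc : HasMFDerivAt 𝓘(ℝ, EG) (𝓘(ℝ, E).prod 𝓘(ℝ, E)) (fun g : G => (g • q₀, g • q₁)) 1
      ((infGen (E := E) EG q₀ : EG →L[ℝ] E).prod (infGen (E := E) EG q₁ : EG →L[ℝ] E)) :=
    (hasMFDerivAt_orbitMap q₀).prodMk (hasMFDerivAt_orbitMap q₁)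
  have key := mfderiv_comp_apply_of_eq (I := 𝓘(ℝ, EG)) (I' := 𝓘(ℝ, E).prod 𝓘(ℝ, E))
    (I'' := 𝓘(ℝ, ℝ)) _ (sys.mdifferentiableAt_L (q₀, q₁)) hc.mdifferentiableAt
    (Prod.ext (one_smul G q₀) (one_smul G q₁)) ξ
  -- By invariance the composite is constant, so its derivative, the sum of the two partial
  -- derivatives, vanishes.
  have e : sys.L ∘ (fun g : G => (g • q₀, g • q₁)) = fun _ => sys.L (q₀, q₁) :=
    funext fun g => hsys.L_smul g q₀ q₁
  rw [e, mfderiv_const, hc.mfderiv] at key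
  exact ((sys.mfderiv_L_apply (q₀, q₁) (infGen EG q₀ ξ, infGen EG q₁ ξ)).symm.trans key.symm)

/-- A curve in a manifold with vanishing velocity near `t₀` is constant near `t₀`. -/
theorem eventually_eq_of_hasMFDerivAt_zero {c : ℝ → Q} {t₀ : ℝ}
    (h : ∀ᶠ t in 𝓝 t₀, HasMFDerivAt 𝓘(ℝ, ℝ) 𝓘(ℝ, E) c t (0 : ℝ →L[ℝ] E)) :
    ∀ᶠ t in 𝓝 t₀, c t = c t₀ := by
  have hs : c ⁻¹' (chartAt E (c t₀)).source ∈ 𝓝 t₀ :=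
    h.self_of_nhds.continuousAt.preimage_mem_nhds (chart_source_mem_nhds E (c t₀))
  -- On a small ball the curve stays in one chart; its coordinate expression has zero derivative on
  -- a convex set, hence is constant there.
  obtain ⟨ε, hε, hball⟩ := Metric.eventually_nhds_iff_ball.1 (h.and hs)
  have hd : ∀ t ∈ Metric.ball t₀ ε,
      HasFDerivAt (fun t => extChartAt 𝓘(ℝ, E) (c t₀) (c t)) (0 : ℝ →L[ℝ] E) t := by
    intro t ht
    have h1 : MDifferentiableAt 𝓘(ℝ, E) 𝓘(ℝ, E) (extChartAt 𝓘(ℝ, E) (c t₀)) (c t) :=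
      have : IsManifold 𝓘(ℝ, E) 1 Q := IsManifold.of_le (n := ∞) (by simp)
      mdifferentiableAt_extChartAt (hball t ht).2
    have h2 := HasMFDerivAt.comp t h1.hasMFDerivAt (hball t ht).1
    let D : E →L[ℝ] E := mfderiv 𝓘(ℝ, E) 𝓘(ℝ, E) (extChartAt 𝓘(ℝ, E) (c t₀)) (c t)
    exact h2.hasFDerivAt.congr_fderiv (D.comp_zero (M₁ := ℝ))
  filter_upwards [Metric.ball_mem_nhds t₀ hε] with t ht
  have hconst := (convex_ball t₀ ε).is_const_of_fderivWithin_eq_zero (𝕜 := ℝ)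
    (fun t ht => (hd t ht).differentiableAt.differentiableWithinAt)
    (fun t ht => by
      rw [fderivWithin_of_isOpen Metric.isOpen_ball ht]
      exact (hd t ht).fderiv) ht (Metric.mem_ball_self hε)
  refine (extChartAt 𝓘(ℝ, E) (c t₀)).injOn ?_ ?_ hconst
  · rw [extChartAt_source]
    exact (hball t ht).2
  · exact mem_extChartAt_source (c t₀)

/-- The infinitesimal generators of a free action do not vanish. -/
theorem infGen_injective [CompleteSpace EG] [LieGroup 𝓘(ℝ, EG) ∞ G]
    [ContMDiffSMul 𝓘(ℝ, EG) 𝓘(ℝ, E) ∞ G Q] [IsCancelSMul G Q] (q : Q) :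
    Function.Injective (infGen (E := E) (G := G) EG q) := by
  rw [injective_iff_map_eq_zero]
  intro ξ hξ
  have : LieGroup 𝓘(ℝ, EG) (minSmoothness ℝ 3) G :=
    LieGroup.of_le (n := ∞) (by simp; exact WithTop.coe_le_coe.2 le_top)
  -- Let `c` be an integral curve through `1` of the left-invariant field of `ξ`. If `ξ_Q(q) = 0`,
  -- then `c t • q` has zero velocity, so it is locally constant; freeness makes `c` locally
  -- constant, and its velocity `ξ` at `1` is zero.
  obtain ⟨c, hc0, hc⟩ := exists_isMIntegralCurveAt_of_contMDiffAt_boundaryless (t₀ := 0)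
    (((contMDiff_mulInvariantVectorField ξ).of_le (n := minSmoothness ℝ 2) (m := 1)
      (by simp)).contMDiffAt (x := (1 : G)))
  have hv : ∀ h : G, mfderiv 𝓘(ℝ, EG) 𝓘(ℝ, E) (fun g : G => g • q) h
      (mulInvariantVectorField (I := 𝓘(ℝ, EG)) ξ h) = 0 := by
    intro h
    have hL : ContMDiff 𝓘(ℝ, EG) 𝓘(ℝ, EG) ∞ (fun g : G => h * g) :=
      contMDiff_const.mul contMDiff_id
    have k1 := mfderiv_comp_apply_of_eq (I := 𝓘(ℝ, EG)) (I' := 𝓘(ℝ, EG)) (I'' := 𝓘(ℝ, E)) _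
      ((contMDiff_orbitMap (E := E) (EG := EG) q).mdifferentiableAt (by simp) (x := h))
      (hL.mdifferentiableAt (by simp) (x := (1 : G))) (mul_one h) ξ
    have k2 := mfderiv_comp_apply_of_eq (I := 𝓘(ℝ, EG)) (I' := 𝓘(ℝ, E)) (I'' := 𝓘(ℝ, E)) _
      ((contMDiff_smul_left (E := E) (EG := EG) h).mdifferentiableAt (by simp) (x := q))
      ((contMDiff_orbitMap (E := E) (EG := EG) q).mdifferentiableAt (by simp) (x := (1 : G)))
      (one_smul G q) ξ
    -- The orbit map intertwines left translation by `h` with the action of `h`, so its derivative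
    -- at `h` sends the left-invariant field to the image of `ξ_Q(q) = 0`.
    have e : (fun g : G => g • q) ∘ (fun g : G => h * g) =
        (fun x : Q => h • x) ∘ (fun g : G => g • q) := funext fun g => mul_smul h g q
    rw [e, k2] at k1
    refine k1.symm.trans ?_
    exact (congrArg (mfderiv 𝓘(ℝ, E) 𝓘(ℝ, E) (fun x : Q => h • x) q) hξ).trans
      (map_zero (mfderiv 𝓘(ℝ, E) 𝓘(ℝ, E) (fun x : Q => h • x) q))
  have hφ : ∀ᶠ t in 𝓝 (0 : ℝ), HasMFDerivAt 𝓘(ℝ, ℝ) 𝓘(ℝ, E) (fun t => c t • q) t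
      (0 : ℝ →L[ℝ] E) := by
    filter_upwards [hc] with t ht
    have k := HasMFDerivAt.comp t
      (((contMDiff_orbitMap (E := E) (EG := EG) q).mdifferentiableAt (by simp)
        (x := c t)).hasMFDerivAt) ht
    let D : EG →L[ℝ] E := mfderiv 𝓘(ℝ, EG) 𝓘(ℝ, E) (fun g : G => g • q) (c t)
    have hD : ∀ x : EG, D x = 0 → D.comp ((1 : ℝ →L[ℝ] ℝ).smulRight x) = 0 := by
      intro x hx
      ext
      simp [hx]
    exact k.congr_mfderiv (hD _ (hv (c t)))
  have hconst : c =ᶠ[𝓝 0] fun _ => c 0 := by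
    filter_upwards [eventually_eq_of_hasMFDerivAt_zero hφ] with t ht
    exact IsCancelSMul.right_cancel _ _ _ ht
  have h0 : HasMFDerivAt 𝓘(ℝ, ℝ) 𝓘(ℝ, EG) c 0 (0 : ℝ →L[ℝ] EG) :=
    (hasMFDerivAt_const (c 0) (0 : ℝ)).congr_of_eventuallyEq hconst
  have huniq := hasMFDerivAt_unique h0 hc.self_of_nhds
  have hinv : mulInvariantVectorField (I := 𝓘(ℝ, EG)) ξ (1 : G) = ξ := by
    have e : (fun g : G => 1 * g) = id := funext one_mul
    rw [mulInvariantVectorField, e, mfderiv_id]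
    rfl
  have hval : (0 : EG) = mulInvariantVectorField (I := 𝓘(ℝ, EG)) ξ (c 0) :=
    (congrArg (fun f : ℝ →L[ℝ] EG => f 1) huniq).trans (one_smul ℝ _)
  rw [hc0] at hval
  exact (hval.trans hinv).symm

end Generators

/-! ### Smooth extension of kernel elements in families of constant rank -/

section ConstantRank

open Module

variable {E M : Type*} [NormedAddCommGroup E] [NormedSpace ℝ E]
  [TopologicalSpace M] [ChartedSpace E M]
  {V F : Type*} [NormedAddCommGroup V] [NormedSpace ℝ V] [FiniteDimensional ℝ V]
  [NormedAddCommGroup F] [NormedSpace ℝ F] [FiniteDimensional ℝ F]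

/-- A family of continuous linear maps on a finite-dimensional space is smooth if it is so
pointwise. -/
theorem contMDiffOn_clm_of_forall_apply {A : M → V →L[ℝ] F} {W : Set M}
    (h : ∀ v, ContMDiffOn 𝓘(ℝ, E) 𝓘(ℝ, F) ∞ (fun x => A x v) W) :
    ContMDiffOn 𝓘(ℝ, E) 𝓘(ℝ, V →L[ℝ] F) ∞ A W := by
  let b := finBasis ℝ V
  let c : Fin (finrank ℝ V) → V →L[ℝ] ℝ := fun i => (b.coord i).toContinuousLinearMap
  -- Expansion in a basis: `A x` is a sum of rank-one maps, each depending linearly on one vector `A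
  -- x (b i)`.
  have e : A = fun x => ∑ i, ContinuousLinearMap.smulRightL ℝ V F (c i) (A x (b i)) := by
    funext x
    ext v
    refine (congrArg (A x) (b.sum_repr v).symm).trans ?_
    rw [map_sum]
    simp [c]
  rw [e]
  refine contMDiffOn_finsetSum fun i _ => ?_
  exact (ContinuousLinearMap.contMDiff _).comp_contMDiffOn (h (b i))

/-- An element of the kernel of `A x₀` extends to a smooth family of elements of the kernels of
`A x`, if the kernels have constant dimension. -/
theorem exists_contMDiffOn_ker_extension {A : M → V →L[ℝ] F} {W : Set M} (hW : IsOpen W)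
    (hA : ContMDiffOn 𝓘(ℝ, E) 𝓘(ℝ, V →L[ℝ] F) ∞ A W) {x₀ : M} (hx₀ : x₀ ∈ W)
    (hrank : ∀ x ∈ W, finrank ℝ (A x).ker = finrank ℝ (A x₀).ker) {v₀ : V} (hv₀ : A x₀ v₀ = 0) :
    ∃ W' ⊆ W, IsOpen W' ∧ x₀ ∈ W' ∧ ∃ s : M → V, ContMDiffOn 𝓘(ℝ, E) 𝓘(ℝ, V) ∞ s W' ∧
      s x₀ = v₀ ∧ ∀ x ∈ W', A x (s x) = 0 := by
  let R := (A x₀).range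
  obtain ⟨P, hP⟩ := R.exists_isCompl.elim fun p hp => (⟨R.projectionOnto p hp, fun x =>
    Submodule.projectionOnto_apply_left hp x⟩ : ∃ P : F →ₗ[ℝ] R, ∀ x : R, P x = x)
  let P' : F →L[ℝ] R := P.toContinuousLinearMap
  have hsurj : Function.Surjective (P ∘ₗ (A x₀ : V →ₗ[ℝ] F)) := by
    rintro ⟨_, v, rfl⟩
    exact ⟨v, hP ⟨_, v, rfl⟩⟩
  obtain ⟨B, hB⟩ := (P ∘ₗ (A x₀ : V →ₗ[ℝ] F)).exists_rightInverse_of_surjective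
    (LinearMap.range_eq_top.2 hsurj)
  let B' : R →L[ℝ] V := B.toContinuousLinearMap
  -- With `P` a projection onto `R = range (A x₀)` and `B` a right inverse of `P ∘ A x₀`, the map `T
  -- x = P ∘ A x ∘ B` is the identity at `x₀`, hence invertible nearby.
  let T : M → R →L[ℝ] R := fun x => (P'.comp (A x)).comp B'
  have hPA : ContMDiffOn 𝓘(ℝ, E) 𝓘(ℝ, V →L[ℝ] R) ∞ (fun x => P'.comp (A x)) W :=
    contMDiffOn_const.clm_comp hA
  have hT : ContMDiffOn 𝓘(ℝ, E) 𝓘(ℝ, R →L[ℝ] R) ∞ T W := hPA.clm_comp contMDiffOn_const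
  have hT₀ : T x₀ = 1 := by
    ext1 y
    exact LinearMap.congr_fun hB y
  let U : Set (R →L[ℝ] R) := {f | IsUnit f}
  have : CompleteSpace R := FiniteDimensional.complete ℝ R
  have hU : IsOpen U := Units.isOpen (R := R →L[ℝ] R)
  have hW' : IsOpen (W ∩ T ⁻¹' U) := hT.continuousOn.isOpen_inter_preimage hW hU
  refine ⟨W ∩ T ⁻¹' U, Set.inter_subset_left, hW', ⟨hx₀, by simp [U, hT₀]⟩,
    -- Correction of `v₀` along the range of `B` that makes `P ∘ A x` vanish; at `x₀` the correction
    -- is zero.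
    fun x => v₀ - B' (Ring.inverse (T x) (P' (A x v₀))), ?_, ?_, ?_⟩
  · have hinv : ContMDiffOn 𝓘(ℝ, E) 𝓘(ℝ, R →L[ℝ] R) ∞ (fun x => Ring.inverse (T x))
        (W ∩ T ⁻¹' U) := by
      intro x hx
      obtain ⟨u, hu⟩ := hx.2
      have h1 : ContDiffAt ℝ ∞ Ring.inverse (T x) := by
        rw [← hu]
        exact contDiffAt_ringInverse (R := R →L[ℝ] R) ℝ u
      exact h1.contMDiffAt.comp_contMDiffWithinAt x ((hT x hx.1).mono Set.inter_subset_left)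
    refine contMDiffOn_const.sub (B'.contMDiff.comp_contMDiffOn (hinv.clm_apply ?_))
    exact (hPA.mono Set.inter_subset_left).clm_apply contMDiffOn_const
  · simp [hv₀]
  · rintro x ⟨hxW, hxU⟩
    have hTinv : T x * Ring.inverse (T x) = 1 := Ring.mul_inverse_cancel _ hxU
    -- Invertibility of `T x` makes `P ∘ A x` onto `R`, so its kernel has the dimension of `ker (A
    -- x₀)`, which is that of `ker (A x)` by constancy of rank. The inclusion of kernels is
    -- therefore an equality.
    have hker : (A x).ker = (P'.comp (A x)).ker := by
      refine Submodule.eq_of_le_of_finrank_le (fun v hv => ?_) ?_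
      · have hv' : A x v = 0 := hv
        simp [hv']
      · have hs : Function.Surjective (P'.comp (A x) : V →ₗ[ℝ] R) := fun y =>
          ⟨B' (Ring.inverse (T x) y), DFunLike.congr_fun hTinv y⟩
        have h1 := LinearMap.finrank_range_add_finrank_ker (P'.comp (A x) : V →ₗ[ℝ] R)
        have h2 := LinearMap.finrank_range_add_finrank_ker (A x₀ : V →ₗ[ℝ] F)
        rw [LinearMap.range_eq_top.2 hs, finrank_top] at h1
        have h3 := hrank x hxW
        change finrank ℝ R + finrank ℝ (A x₀).ker = _ at h2
        change finrank ℝ R + finrank ℝ (P'.comp (A x)).ker = _ at h1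
        omega
    have hmem : v₀ - B' (Ring.inverse (T x) (P' (A x v₀))) ∈ (P'.comp (A x)).ker := by
      have h1 : P' (A x (B' (Ring.inverse (T x) (P' (A x v₀))))) = P' (A x v₀) :=
        DFunLike.congr_fun hTinv (P' (A x v₀))
      simp [h1]
    rw [← hker] at hmem
    exact hmem

/-- If `B (v, a)` vanishes exactly when `T v = ∑ i, a i • X i`, where `T` is injective and `X` is
linearly independent, then the kernel of `B` has the dimension of `range T ⊓ span X`. -/
theorem finrank_ker_eq_finrank_range_inf_span {V F F' : Type*} [AddCommGroup V] [Module ℝ V]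
    [AddCommGroup F] [Module ℝ F] [AddCommGroup F'] [Module ℝ F'] {d : ℕ} {T : V →ₗ[ℝ] F}
    (hT : Function.Injective T) {X : Fin d → F} (hX : LinearIndependent ℝ X)
    {B : V × (Fin d → ℝ) →ₗ[ℝ] F'} (hB : ∀ v a, B (v, a) = 0 ↔ T v = ∑ i, a i • X i) :
    finrank ℝ B.ker =
      finrank ℝ (T.range ⊓ Submodule.span ℝ (Set.range X) : Submodule ℝ F) := by
  have hmem : ∀ x : B.ker, T x.1.1 ∈ T.range ⊓ Submodule.span ℝ (Set.range X) := fun x =>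
    ⟨⟨_, rfl⟩, (Submodule.mem_span_range_iff_exists_fun ℝ).2
      ⟨x.1.2, ((hB x.1.1 x.1.2).1 x.2).symm⟩⟩
  -- The isomorphism is `(v, a) ↦ T v`: independence of `X` makes `a` determined by `T v`.
  let f : B.ker →ₗ[ℝ] (T.range ⊓ Submodule.span ℝ (Set.range X) : Submodule ℝ F) :=
    ((T ∘ₗ LinearMap.fst ℝ V (Fin d → ℝ)) ∘ₗ B.ker.subtype).codRestrict _ hmem
  refine (LinearEquiv.ofBijective f ⟨?_, ?_⟩).finrank_eq
  · rw [injective_iff_map_eq_zero]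
    rintro ⟨⟨v, a⟩, hva⟩ h
    have h1 : T v = 0 := congrArg Subtype.val h
    have h2 : ∑ i, a i • X i = 0 := ((hB v a).1 hva).symm.trans h1
    have h3 : v = 0 := hT (h1.trans (map_zero T).symm)
    have h4 : a = 0 := funext (Fintype.linearIndependent_iff.1 hX a h2)
    subst h3 h4
    rfl
  · rintro ⟨_, ⟨v, rfl⟩, hv⟩
    obtain ⟨a, ha⟩ := (Submodule.mem_span_range_iff_exists_fun ℝ).1 hv
    exact ⟨⟨(v, a), (hB v a).2 ha.symm⟩, rfl⟩

end ConstantRank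

/-! ### Sections of `𝔤^𝒟` -/

section Sections

open Module Bundle

variable {EG G E Q : Type*} [NormedAddCommGroup EG] [NormedSpace ℝ EG]
    [TopologicalSpace G] [ChartedSpace EG G] [Group G]
    [NormedAddCommGroup E] [NormedSpace ℝ E]
    [TopologicalSpace Q] [ChartedSpace E Q] [MulAction G Q] [IsManifold 𝓘(ℝ, E) ∞ Q]
    [LieGroup 𝓘(ℝ, EG) ∞ G] [ContMDiffSMul 𝓘(ℝ, EG) 𝓘(ℝ, E) ∞ G Q]

/-- The infinitesimal generators are smooth vector fields. -/
theorem contMDiff_infGen (ξ : GroupLieAlgebra 𝓘(ℝ, EG) G) :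
    ContMDiff 𝓘(ℝ, E) 𝓘(ℝ, E).tangent ∞
      (fun q : Q => (⟨q, infGen EG q ξ⟩ : TangentBundle 𝓘(ℝ, E) Q)) := by
  have hsm : ContMDiff (𝓘(ℝ, EG).prod 𝓘(ℝ, E)) 𝓘(ℝ, E) ∞ (fun p : G × Q => p.1 • p.2) :=
    contMDiff_smul (I := 𝓘(ℝ, EG)) (I' := 𝓘(ℝ, E)) (n := ∞) (G := G) (M := Q)
  -- The generator at `q` is the tangent map of the action applied to the pair of `ξ` at `1` and the
  -- zero vector at `q`.
  let F₁ : Q → TangentBundle 𝓘(ℝ, EG) G × TangentBundle 𝓘(ℝ, E) Q :=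
    fun q => (TotalSpace.mk' EG 1 ξ, TotalSpace.mk' E q 0)
  have S₁ : ContMDiff 𝓘(ℝ, E) (𝓘(ℝ, EG).tangent.prod 𝓘(ℝ, E).tangent) ∞ F₁ :=
    contMDiff_const.prodMk (contMDiff_zeroSection _ _)
  have S₂ : ContMDiff (𝓘(ℝ, EG).tangent.prod 𝓘(ℝ, E).tangent) (𝓘(ℝ, EG).prod 𝓘(ℝ, E)).tangent ∞
      (equivTangentBundleProd 𝓘(ℝ, EG) G 𝓘(ℝ, E) Q).symm := contMDiff_equivTangentBundleProd_symm
  have S₃ : ContMDiff (𝓘(ℝ, EG).prod 𝓘(ℝ, E)).tangent 𝓘(ℝ, E).tangent ∞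
      (tangentMap (𝓘(ℝ, EG).prod 𝓘(ℝ, E)) 𝓘(ℝ, E) (fun p : G × Q => p.1 • p.2)) :=
    hsm.contMDiff_tangentMap (m := ∞) (by rfl)
  have S := (S₃.comp S₂).comp S₁
  refine S.congr fun q => ?_
  have h : mfderiv (𝓘(ℝ, EG).prod 𝓘(ℝ, E)) 𝓘(ℝ, E) (fun p : G × Q => p.1 • p.2) (1, q)
      (((ξ : EG), (0 : E)) : EG × E) = infGen EG q ξ :=
    (mfderiv_prod_eq_add_apply (hsm.mdifferentiableAt (by simp))).trans
      ((congrArg (infGen EG q ξ + ·) (map_zero _)).trans (add_zero _))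
  exact TotalSpace.ext (one_smul G q).symm (heq_of_eq (show (infGen EG q ξ : E) = _ from h.symm))

/-- With a local frame `X` of `𝒟`, the pairs `(ξ, a)` with `ξ_Q(q) = ∑ a i • X i q` form the kernel
of a smooth family of linear maps. This kernel is isomorphic to `𝒮_q`, so its dimension is locally
constant and the kernel extension applies; the first component is a local section of `𝔤^𝒟`. -/
theorem DiscreteSystem.exists_gDSection [FiniteDimensional ℝ EG] [FiniteDimensional ℝ E]
    [T2Space Q] [IsCancelSMul G Q] (sys : DiscreteSystem E Q)
    (hS : IsLocallyConstant fun q : Q => finrank ℝ (sys.S EG G q)) (q₀ : Q)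
    {η : GroupLieAlgebra 𝓘(ℝ, EG) G} (hη : η ∈ sys.gD EG G q₀) :
    ∃ ξ : sys.GDSection EG G, ξ.toFun q₀ = η := by
  have : CompleteSpace EG := FiniteDimensional.complete ℝ EG
  obtain ⟨W₁, hW₁, hqW₁, d, X, hX, hXD⟩ := sys.subbundle_D q₀
  let e := trivializationAt E (TangentSpace 𝓘(ℝ, E) : Q → Type _) q₀
  let W₂ : Set Q := {q | finrank ℝ (sys.S EG G q) = finrank ℝ (sys.S EG G q₀)}
  have hW₂ : IsOpen W₂ := hS.isOpen_fiber _
  let W := W₁ ∩ e.baseSet ∩ W₂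
  have hW : IsOpen W := (hW₁.inter e.open_baseSet).inter hW₂
  have hqW : q₀ ∈ W := ⟨⟨hqW₁, mem_baseSet_trivializationAt E _ q₀⟩, rfl⟩
  let T : Q → EG →L[ℝ] E := fun q => infGen (E := E) (G := G) EG q
  let L : Q → E →L[ℝ] E := fun q => e.continuousLinearMapAt ℝ q
  let Y : Fin d → Q → E := fun i q => X i q
  -- The trivialization `L` lets all these maps act between fixed vector spaces; over its base set
  -- it is injective on fibres and leaves the kernel unchanged.
  let A : Q → (EG × (Fin d → ℝ)) →L[ℝ] E := fun q =>
    (L q).comp ((T q).comp (ContinuousLinearMap.fst ℝ EG (Fin d → ℝ)) - ∑ i,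
      ((ContinuousLinearMap.proj i).comp (ContinuousLinearMap.snd ℝ EG (Fin d → ℝ))).smulRight
        (Y i q))
  have hA_apply : ∀ q v a, A q (v, a) = L q (T q v) - ∑ i, a i • L q (Y i q) := by
    intro q v a
    simp [A]
  have hL : ∀ q ∈ e.baseSet, ∀ v : TangentSpace 𝓘(ℝ, E) q, L q v = (e ⟨q, v⟩).2 :=
    fun q hq v => by
      change e.continuousLinearMapAt ℝ q v = _
      rw [Trivialization.continuousLinearMapAt_apply, e.coe_linearMapAt_of_mem hq]
  have hLinj : ∀ q ∈ e.baseSet, ∀ v : E, L q v = 0 → v = 0 := fun q hq v hv => by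
    have h := e.symmL_continuousLinearMapAt (R := ℝ) hq v
    have h' : e.continuousLinearMapAt ℝ q v = 0 := hv
    rw [h', map_zero] at h
    exact h.symm
  have hker : ∀ q ∈ e.baseSet, ∀ v a, A q (v, a) = 0 ↔ T q v = ∑ i, a i • Y i q := by
    intro q hq v a
    have h : A q (v, a) = L q (T q v - ∑ i, a i • Y i q) := by
      rw [hA_apply, map_sub, map_sum]
      simp
    rw [h]
    exact ⟨fun h => sub_eq_zero.1 (hLinj q hq _ h), fun h => by rw [sub_eq_zero.2 h, map_zero]⟩
  have hA : ContMDiffOn 𝓘(ℝ, E) 𝓘(ℝ, (EG × (Fin d → ℝ)) →L[ℝ] E) ∞ A W := by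
    refine contMDiffOn_clm_of_forall_apply fun va => ?_
    have h1 : ContMDiffOn 𝓘(ℝ, E) 𝓘(ℝ, E) ∞ (fun q => L q (T q va.1)) W := by
      refine ((e.contMDiffOn_section_iff hW fun q hq => hq.1.2).1
        (contMDiff_infGen (E := E) (Q := Q) (G := G) va.1).contMDiffOn).congr fun q hq => ?_
      exact hL q hq.1.2 _
    have h2 : ∀ i, ContMDiffOn 𝓘(ℝ, E) 𝓘(ℝ, E) ∞ (fun q => L q (Y i q)) W := by
      intro i
      refine ((e.contMDiffOn_section_iff hW fun q hq => hq.1.2).1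
        ((hX i).mono fun q hq => hq.1.1)).congr fun q hq => ?_
      exact hL q hq.1.2 _
    have h3 : ContMDiffOn 𝓘(ℝ, E) 𝓘(ℝ, E) ∞ (fun q => ∑ i, va.2 i • L q (Y i q)) W :=
      contMDiffOn_finsetSum fun i _ => (contDiff_const_smul (va.2 i)).contMDiff.comp_contMDiffOn (h2 i)
    exact (h1.sub h3).congr fun q _ => hA_apply q va.1 va.2
  have hrank : ∀ q ∈ W, finrank ℝ (A q).ker = finrank ℝ (sys.S EG G q) := by
    intro q hq
    rw [DiscreteSystem.S, ← (hXD q hq.1.1).2]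
    exact finrank_ker_eq_finrank_range_inf_span (F := TangentSpace 𝓘(ℝ, E) q)
      (T := (infGen (E := E) (G := G) EG q).toLinearMap) (infGen_injective q) (hXD q hq.1.1).1
      (hker q hq.1.2)
  have hη' : infGen EG q₀ η ∈ Submodule.span ℝ (Set.range fun i => X i q₀) := by
    rw [(hXD q₀ hqW₁).2]
    exact hη
  obtain ⟨a, ha⟩ := (Submodule.mem_span_range_iff_exists_fun ℝ).1 hη'
  obtain ⟨W', hW'W, hW', hqW', s, hs, hs₀, hsA⟩ := exists_contMDiffOn_ker_extension hW hA hqW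
    (fun q hq => ((hrank q hq).trans hq.2).trans (hrank q₀ hqW).symm) (v₀ := (η, a))
    ((hker q₀ hqW.1.2 η a).2 ha.symm)
  -- The cutoff is supported where `s` is smooth and equals `1` at `q₀`; fibrewise scaling stays in
  -- `𝔤^𝒟`.
  obtain ⟨f, -, hf⟩ := (SmoothBumpFunction.nhds_basis_tsupport (I := 𝓘(ℝ, E)) q₀).mem_iff.1
    (hW'.mem_nhds hqW')
  refine ⟨⟨fun q => f q • ((s q).1 : EG), ?_, ?_⟩, ?_⟩
  · refine contMDiff_of_tsupport fun q hq => ?_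
    have hq' : q ∈ W' := hf (tsupport_smul_subset_left _ _ hq)
    exact f.contMDiffAt.smul
      ((ContinuousLinearMap.fst ℝ EG (Fin d → ℝ)).contMDiff.contMDiffAt.comp q
        ((hs q hq').contMDiffAt (hW'.mem_nhds hq')))
  · intro q
    by_cases hq : q ∈ tsupport f
    · refine Submodule.smul_mem (sys.gD EG G q) (f q) ?_
      have hqW := hW'W (hf hq)
      change infGen EG q (s q).1 ∈ sys.D q
      rw [← (hXD q hqW.1.1).2]
      exact (Submodule.mem_span_range_iff_exists_fun ℝ).2
        ⟨(s q).2, ((hker q hqW.1.2 (s q).1 (s q).2).1 (hsA q (hf hq))).symm⟩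
    · rw [image_eq_zero_of_notMem_tsupport hq]
      have h : (0 : ℝ) • ((s q).1 : EG) = 0 := zero_smul ℝ _
      exact h ▸ Submodule.zero_mem (sys.gD EG G q)
  · change f q₀ • ((s q₀).1 : EG) = η
    rw [f.eq_one, one_smul, hs₀]

end Sections

/-! ### The vertical equation in terms of the discrete lagrangian -/

section Reconstruction

variable {EG G E Q : Type*} [NormedAddCommGroup EG] [NormedSpace ℝ EG]
    [TopologicalSpace G] [ChartedSpace EG G] [Group G]
    [NormedAddCommGroup E] [NormedSpace ℝ E]
    [TopologicalSpace Q] [ChartedSpace E Q] [MulAction G Q]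

namespace AffineDiscreteConnection

variable (A : AffineDiscreteConnection EG G E Q)

theorem form_spec {a b : Q} (h : (a, b) ∈ A.domain) :
    (a, (A.form a b h)⁻¹ • b) ∈ A.Hor ∩ A.U :=
  h.exists.choose_spec

/-- Horizontal lifts are defined on the domain of the discrete connection. -/
theorem mem_liftDomain_of_mem_domain [IsCancelSMul G Q] {a b : Q} (h : (a, b) ∈ A.domain) :
    (a, orbitProj G b) ∈ A.liftDomain := by
  refine ⟨(A.form a b h)⁻¹ • b, ⟨A.form_spec h, orbitProj_smul _ _⟩, ?_⟩
  rintro y ⟨hy, hyb⟩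
  obtain ⟨g, rfl⟩ := orbitProj_eq_iff.1 hyb
  -- A competing horizontal point is `g • b`, so `g⁻¹` satisfies the condition that singles out the
  -- connection form.
  have hg : g⁻¹ = A.form a b h :=
    h.unique (by simpa using hy) (A.form_spec h)
  rw [← hg, inv_inv]

/-- The discrete connection recovers the end point of a pair of points in its domain. -/
theorem F₁_form {a b : Q} (h : (a, b) ∈ A.domain) (h' : (a, orbitProj G b) ∈ A.liftDomain) :
    A.F₁ a (A.form a b h) (orbitProj G b) h' = b := by
  have hl : A.hlift a (orbitProj G b) h' = (A.form a b h)⁻¹ • b :=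
    h'.unique (A.hlift_spec _ _ h') ⟨A.form_spec h, orbitProj_smul _ _⟩
  rw [F₁, hl, smul_inv_smul]

/-- The proof `h'` depends on `y` and `r`; stating the identifications as equations allows them to
be substituted. -/
theorem F₁_eq {a b y : Q} {u : G} {r : MulAction.orbitRel.Quotient G Q} (h : (a, b) ∈ A.domain)
    (h' : (y, r) ∈ A.liftDomain) (hy : y = a) (hu : u = A.form a b h) (hr : r = orbitProj G b) :
    A.F₁ y u r h' = b := by
  subst hy hu hr
  exact A.F₁_form h h'

end AffineDiscreteConnection

variable [IsManifold 𝓘(ℝ, E) ∞ Q] {A : AffineDiscreteConnection EG G E Q}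

/-- The point `q₂ = F̃₁(q₁, w₁, r₂)`. -/
def VertPoint.q₂ (x : VertPoint A) : Q :=
  A.F₁ x.q₁ x.w₁ x.r₂ x.dom₂

theorem VertPoint.q₁_eq (x : VertPoint A) {a b : Q} (hab : (a, b) ∈ A.domain) (h₀ : x.q₀ = a)
    (hw : x.w₀ = A.form a b hab) (hr : x.r₁ = orbitProj G b) : x.q₁ = b :=
  A.F₁_eq hab x.dom₁ h₀ hw hr

theorem VertPoint.q₂_eq [IsCancelSMul G Q] (x : VertPoint A) {b c : Q} (hbc : (b, c) ∈ A.domain)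
    (h₁ : x.q₁ = b) (hv : x.v₁ = rho b (A.form b c hbc)) (hr : x.r₂ = orbitProj G c) :
    x.q₂ = c := by
  -- Freeness makes the group coordinate over a given point unique.
  have hw : x.w₁ = A.form b c hbc := by
    apply rho_injective (q := x.q₁)
    rw [VertPoint.w₁, rho_groupCoord, hv, h₁]
  exact A.F₁_eq hbc x.dom₂ h₁ hw hr

variable [LieGroup 𝓘(ℝ, EG) ∞ G] [ContMDiffSMul 𝓘(ℝ, EG) 𝓘(ℝ, E) ∞ G Q]

/-- Since `F̃₁(q₀, s w, r₁) = s • F̃₁(q₀, w, r₁)`, translating to `1` differentiates `L_d` along the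
orbit of the end point. -/
theorem translateToOne_D₂Lcheck_eq (sys : DiscreteSystem E Q) (q₀ : Q) (w : G)
    (r₁ : MulAction.orbitRel.Quotient G Q) (h : (q₀, r₁) ∈ A.liftDomain)
    (ξ : GroupLieAlgebra 𝓘(ℝ, EG) G) :
    translateToOne (D₂Lcheck sys A q₀ w r₁ h) ξ =
      sys.D₂L q₀ (A.F₁ q₀ w r₁ h) (infGen EG (A.F₁ q₀ w r₁ h) ξ) := by
  rw [translateToOne_D₂Lcheck, ← sys.D₂L_infGen]
  have e : (fun s : G => Lcheck sys A q₀ (s * w) r₁ h) =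
      fun s : G => sys.L (q₀, s • A.F₁ q₀ w r₁ h) := by
    funext s
    rw [Lcheck, AffineDiscreteConnection.F₁, mul_smul, AffineDiscreteConnection.F₁]
  rw [e]
  rfl

/-- The second covector gives a `D₂L` term at `q₂`; infinitesimal invariance trades it for minus a
`D₁L` term at `q₁`. -/
theorem psiCheck_eq {sys : DiscreteSystem E Q} (hsys : sys.IsSymmetric G) (x : VertPoint A) :
    psiCheck sys x = sys.D₂L x.q₀ x.q₁ (infGen EG x.q₁ x.ξ₁) +
      sys.D₁L x.q₁ x.q₂ (infGen EG x.q₁ x.ξ₁) := by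
  have h := hsys.D₁L_add_D₂L_infGen x.q₁ x.q₂ x.ξ₁
  have h1 := translateToOne_D₂Lcheck_eq sys x.q₀ x.w₀ x.r₁ x.dom₁ x.ξ₁
  have h2 := translateToOne_D₂Lcheck_eq sys x.q₁ x.w₁ x.r₂ x.dom₂ x.ξ₁
  rw [psiCheck, sub_apply, h1, h2]
  change sys.D₂L x.q₀ x.q₁ (infGen EG x.q₁ x.ξ₁) - sys.D₂L x.q₁ x.q₂ (infGen EG x.q₂ x.ξ₁) = _
  linarith

/-- `𝔤^𝒟` is invariant under `g • (q, ξ) = (g • q, Ad_g ξ)`. -/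
theorem DiscreteSystem.IsSymmetric.Ad_mem_gD {sys : DiscreteSystem E Q}
    (hsys : sys.IsSymmetric G) (g : G) {q : Q} {ξ : GroupLieAlgebra 𝓘(ℝ, EG) G}
    (hξ : ξ ∈ sys.gD EG G q) : Ad EG g ξ ∈ sys.gD EG G (g • q) := by
  have h1 : g * 1 * g⁻¹ = 1 := by simp
  have k1 := mfderiv_comp_apply_of_eq (I := 𝓘(ℝ, EG)) (I' := 𝓘(ℝ, EG)) (I'' := 𝓘(ℝ, E)) _
    ((contMDiff_orbitMap (E := E) (EG := EG) (g • q)).mdifferentiableAt (by simp) (x := (1 : G)))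
    (mdiff_conj (EG := EG) g (1 : G)) h1 ξ
  have k2 := mfderiv_comp_apply_of_eq (I := 𝓘(ℝ, EG)) (I' := 𝓘(ℝ, E)) (I'' := 𝓘(ℝ, E)) _
    ((contMDiff_smul_left (E := E) (EG := EG) g).mdifferentiableAt (by simp) (x := q))
    ((contMDiff_orbitMap (E := E) (EG := EG) q).mdifferentiableAt (by simp) (x := (1 : G)))
    (one_smul G q) ξ
  -- Differentiating this identity at `1` gives `(Ad_g ξ)_Q(g • q)` as the image of `ξ_Q(q)` under
  -- the lifted action.
  have e : (fun h : G => h • g • q) ∘ (fun h : G => g * h * g⁻¹) =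
      (fun x : Q => g • x) ∘ (fun h : G => h • q) := by
    funext h
    simp [mul_smul]
  rw [e, k2] at k1
  have k3 : infGen EG (g • q) (Ad EG g ξ) =
      mfderiv 𝓘(ℝ, E) 𝓘(ℝ, E) (fun x : Q => g • x) q (infGen EG q ξ) := k1.symm
  change infGen EG (g • q) (Ad EG g ξ) ∈ sys.D (g • q)
  rw [k3]
  exact hsys.D_smul g q _ hξ

/-- The elements of `(F₁^* 𝔤^𝒟)/G` over the reduction of `(a, b, c)` annihilate `ψ̄` if and only if
`(a, b, c)` satisfies the vertical discrete Lagrange–d'Alembert equation. -/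
theorem psiBar_eq_zero_iff [IsCancelSMul G Q] {sys : DiscreteSystem E Q}
    (hsys : sys.IsSymmetric G) {a b c : Q} (hab : (a, b) ∈ A.domain) (hbc : (b, c) ∈ A.domain) :
    (∀ z ∈ gDBundle sys A, z.base = (rho a (A.form a b hab), orbitProj G b,
        rho b (A.form b c hbc), orbitProj G c) → psiBar sys hsys z = 0) ↔
      ∀ ξ ∈ sys.gD EG G b,
        sys.D₂L a b (infGen EG b ξ) + sys.D₁L b c (infGen EG b ξ) = 0 := by
  constructor
  · intro h ξ hξ
    have d₁ := A.mem_liftDomain_of_mem_domain hab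
    let x : VertPoint A :=
      { q₀ := a
        w₀ := A.form a b hab
        r₁ := orbitProj G b
        v₁ := rho b (A.form b c hbc)
        r₂ := orbitProj G c
        ξ₁ := ξ
        fib := rfl
        dom₁ := d₁
        dom₂ := by
          rw [A.F₁_form hab d₁]
          exact A.mem_liftDomain_of_mem_domain hbc }
    have h₁ : x.q₁ = b := x.q₁_eq hab rfl rfl rfl
    have h₂ : x.q₂ = c := x.q₂_eq hbc h₁ rfl rfl
    have hx : psiCheck sys x = 0 := h _ ⟨x, by
      change ξ ∈ sys.gD EG G x.q₁
      rwa [h₁], rfl⟩ rfl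
    rw [psiCheck_eq hsys, h₁, h₂] at hx
    exact hx
  · rintro h _ ⟨x, hx, rfl⟩ hbase
    obtain ⟨hv₀, hr₁, hv₁, hr₂⟩ : rho x.q₀ x.w₀ = rho a (A.form a b hab) ∧
        x.r₁ = orbitProj G b ∧ x.v₁ = rho b (A.form b c hbc) ∧ x.r₂ = orbitProj G c := by
      have h' : (rho x.q₀ x.w₀, x.r₁, x.v₁, x.r₂) = (rho a (A.form a b hab), orbitProj G b,
        rho b (A.form b c hbc), orbitProj G c) := hbase
      simpa only [Prod.mk.injEq] using h'
    -- The base point fixes `(q₀, w₀)` only up to `G`; the representative is moved so that it starts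
    -- at `a`, and the remaining data then force `q₁ = b` and `q₂ = c`.
    obtain ⟨g, hg⟩ := Quotient.exact hv₀.symm
    have h₀ : (g • x).q₀ = a := congrArg ConjPair.q hg
    have h₁ : (g • x).q₁ = b :=
      (g • x).q₁_eq hab h₀ (congrArg ConjPair.w hg) hr₁
    have h₂ : (g • x).q₂ = c := (g • x).q₂_eq hbc h₁ hv₁ hr₂
    have hmem : (g • x).ξ₁ ∈ sys.gD EG G b := by
      rw [← h₁, x.smul_q₁ g]
      exact hsys.Ad_mem_gD g hx
    have hψ := psiCheck_eq hsys (g • x)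
    rw [psiCheck_smul hsys, h₀, h₁, h₂] at hψ
    exact hψ.trans (h _ hmem)

end Reconstruction

/-! ### The discrete action and the momentum equation along a curve -/

section Curves

variable {EG G E Q : Type*} [NormedAddCommGroup EG] [NormedSpace ℝ EG]
    [TopologicalSpace G] [ChartedSpace EG G] [Group G]
    [NormedAddCommGroup E] [NormedSpace ℝ E]
    [TopologicalSpace Q] [ChartedSpace E Q] [MulAction G Q] [IsManifold 𝓘(ℝ, E) ∞ Q]

/-- Criticality of the discrete action for variations in `𝒮` with fixed end points, as an equation
on consecutive triples of points. -/
theorem DiscreteSystem.dAction_eq_zero_iff (sys : DiscreteSystem E Q) {N : ℕ}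
    (q : Fin (N + 1) → Q) :
    (∀ δq : ∀ k, TangentSpace 𝓘(ℝ, E) (q k), δq 0 = 0 → δq (Fin.last N) = 0 →
        (∀ k, δq k ∈ sys.S EG G (q k)) → sys.dAction q δq = 0) ↔
      ∀ (k : ℕ) (h₀ : k < N + 1) (h₁ : k + 1 < N + 1) (h₂ : k + 2 < N + 1),
        ∀ ξ ∈ sys.gD EG G (q ⟨k + 1, h₁⟩),
          sys.D₂L (q ⟨k, h₀⟩) (q ⟨k + 1, h₁⟩) (infGen EG (q ⟨k + 1, h₁⟩) ξ) +
            sys.D₁L (q ⟨k + 1, h₁⟩) (q ⟨k + 2, h₂⟩) (infGen EG (q ⟨k + 1, h₁⟩) ξ) = 0 := by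
  constructor
  · intro h k h₀ h₁ h₂ ξ hξ
    have hk : k + 1 < N := Nat.lt_of_succ_lt_succ h₂
    let i : Fin (N + 1) := ⟨k + 1, h₁⟩
    -- A variation concentrated at one interior vertex meets only two edges: the one ending there
    -- (`D₂L`) and the one starting there (`D₁L`).
    let δq : ∀ j, TangentSpace 𝓘(ℝ, E) (q j) := Pi.single i (infGen EG (q i) ξ)
    have hne : ∀ j, j ≠ i → δq j = 0 := fun j hj => Pi.single_eq_of_ne hj _
    have hi : δq i = infGen EG (q i) ξ := Pi.single_eq_same i _
    have hcrit := h δq (hne 0 (by simp [i, Fin.ext_iff])) (hne (Fin.last N) (by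
      simp only [ne_eq, i, Fin.ext_iff, Fin.val_last]
      omega)) (fun j => by
        by_cases hj : j = i
        · subst hj
          rw [hi]
          exact ⟨⟨ξ, rfl⟩, hξ⟩
        · rw [hne j hj]
          exact Submodule.zero_mem _)
    rw [sys.dAction_eq_sum, Finset.sum_add_distrib,
      Finset.sum_eq_single (⟨k + 1, hk⟩ : Fin N), Finset.sum_eq_single (⟨k, Nat.lt_of_succ_lt hk⟩ : Fin N)]
      at hcrit
    · change sys.D₁L _ _ (δq i) + sys.D₂L _ _ (δq i) = 0 at hcrit
      rw [hi, add_comm] at hcrit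
      exact hcrit
    · intro j _ hj
      rw [hne j.succ (by simpa [i, Fin.ext_iff] using hj), map_zero]
    · simp
    · intro j _ hj
      rw [hne j.castSucc (by simpa [i, Fin.ext_iff] using hj), map_zero]
    · simp
  · intro h δq h0 hN hS
    rw [sys.dAction_eq_sum, Finset.sum_add_distrib]
    cases N with
    | zero => simp
    | succ M =>
      -- The first `D₁L` term and the last `D₂L` term involve only the fixed end points; without
      -- them both sums run over the interior vertices.
      rw [Fin.sum_univ_succ, Fin.sum_univ_castSucc (n := M)
        (f := fun k => sys.D₂L (q k.castSucc) (q k.succ) (δq k.succ))]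
      have e0 : sys.D₁L (q (Fin.castSucc (0 : Fin (M + 1)))) (q (Fin.succ 0))
          (δq (Fin.castSucc 0)) = 0 :=
        (congrArg (sys.D₁L (q 0) (q (Fin.succ 0))) h0).trans (map_zero _)
      have eN : sys.D₂L (q (Fin.last M).castSucc) (q (Fin.last M).succ) (δq (Fin.last M).succ) = 0 :=
        (congrArg (sys.D₂L (q (Fin.last M).castSucc) (q (Fin.last (M + 1)))) hN).trans (map_zero _)
      rw [e0, eN, zero_add, add_zero, ← Finset.sum_add_distrib]
      refine Finset.sum_eq_zero fun i _ => ?_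
      obtain ⟨⟨ξ, hξ⟩, hD⟩ := hS i.succ.castSucc
      have hξ' : infGen EG (q i.succ.castSucc) ξ = δq i.succ.castSucc := hξ
      have hmem : ξ ∈ sys.gD EG G (q i.succ.castSucc) := by
        change infGen EG _ ξ ∈ sys.D _
        rw [hξ']
        exact hD
      have hk := h i i.castSucc.castSucc.2 i.succ.castSucc.2 i.succ.succ.2 ξ hmem
      change sys.D₂L _ _ (infGen EG (q i.succ.castSucc) ξ) +
        sys.D₁L _ _ (infGen EG (q i.succ.castSucc) ξ) = 0 at hk
      rw [hξ', add_comm] at hk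
      exact hk

/-- The momentum equation for a section of `𝔤^𝒟`. -/
theorem DiscreteSystem.IsSymmetric.JSection_sub_eq_iff [ContMDiffSMul 𝓘(ℝ, EG) 𝓘(ℝ, E) ∞ G Q]
    {sys : DiscreteSystem E Q} (hsys : sys.IsSymmetric G) (ξ : sys.GDSection EG G) (a b c : Q) :
    sys.JSection ξ b c - sys.JSection ξ a b =
        -sys.D₁L a b (infGen EG a (ξ.toFun b - ξ.toFun a)) ↔
      sys.D₂L a b (infGen EG b (ξ.toFun b)) + sys.D₁L b c (infGen EG b (ξ.toFun b)) = 0 := by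
  -- The terms in `ξ(a)` cancel, leaving `D₁L(a,b)` on the generator of `ξ(b)` at `a`, which
  -- invariance moves to `b`.
  have h := hsys.D₁L_add_D₂L_infGen a b (ξ.toFun b)
  have hbc : sys.JSection ξ b c = -sys.D₁L b c (infGen EG b (ξ.toFun b)) := rfl
  have hab : sys.JSection ξ a b = -sys.D₁L a b (infGen EG a (ξ.toFun a)) := rfl
  rw [hbc, hab, map_sub, map_sub]
  constructor <;> intro h' <;> linarith

end Curves

end DiscreteMech

end

/-! ### The equivalence of the three conditions -/

theorem mainTheorem4
    {EG G E Q : Type*}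
    [NormedAddCommGroup EG] [NormedSpace ℝ EG] [FiniteDimensional ℝ EG]
    [TopologicalSpace G] [ChartedSpace EG G] [Group G] [LieGroup 𝓘(ℝ, EG) ∞ G]
    [NormedAddCommGroup E] [NormedSpace ℝ E] [FiniteDimensional ℝ E]
    [TopologicalSpace Q] [T2Space Q] [ChartedSpace E Q] [IsManifold 𝓘(ℝ, E) ∞ Q]
    [MulAction G Q] [ContMDiffSMul 𝓘(ℝ, EG) 𝓘(ℝ, E) ∞ G Q] [IsCancelSMul G Q] [ProperSMul G Q]
    (sys : DiscreteSystem E Q) (hsys : sys.IsSymmetric G)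
    (hS : IsLocallyConstant fun q : Q => Module.finrank ℝ (sys.S EG G q))
    (A : AffineDiscreteConnection EG G E Q)
    {N : ℕ} (q : Fin (N + 1) → Q)
    (hq : ∀ k : Fin N, (q k.castSucc, q k.succ) ∈ A.domain)
    (r : Fin (N + 1) → MulAction.orbitRel.Quotient G Q) (hr : ∀ k, r k = orbitProj G (q k))
    (w : Fin N → G) (hw : ∀ k, w k = A.form (q k.castSucc) (q k.succ) (hq k))
    (v : Fin N → ConjBundle Q G) (hv : ∀ k, v k = rho (q k.castSucc) (w k)) :
    List.TFAE [
      ∀ δq : ∀ k, TangentSpace 𝓘(ℝ, E) (q k), δq 0 = 0 → δq (Fin.last N) = 0 →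
        (∀ k, δq k ∈ sys.S EG G (q k)) → sys.dAction q δq = 0,
      ∀ (k : ℕ) (hk : k + 1 < N), ∀ z ∈ gDBundle sys A,
        z.base = (v ⟨k, by omega⟩, r ⟨k + 1, by omega⟩, v ⟨k + 1, by omega⟩, r ⟨k + 2, by omega⟩) →
          psiBar sys hsys z = 0,
      ∀ ξ : sys.GDSection EG G, ∀ (k : ℕ) (hk : k + 1 < N),
        sys.JSection ξ (q ⟨k + 1, by omega⟩) (q ⟨k + 2, by omega⟩) -
            sys.JSection ξ (q ⟨k, by omega⟩) (q ⟨k + 1, by omega⟩) =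
          -sys.D₁L (q ⟨k, by omega⟩) (q ⟨k + 1, by omega⟩)
            (infGen EG (q ⟨k, by omega⟩)
              (ξ.toFun (q ⟨k + 1, by omega⟩) - ξ.toFun (q ⟨k, by omega⟩)))] := by
  tfae_have 1 ↔ 2 := by
    rw [sys.dAction_eq_zero_iff]
    -- Here `k` indexes the first point of a triple, so the interior point is `k + 1`.
    have key := fun (k : ℕ) (hk : k + 1 < N) =>
      psiBar_eq_zero_iff hsys (hq ⟨k, Nat.lt_of_succ_lt hk⟩) (hq ⟨k + 1, hk⟩)
    constructor
    · intro h k hk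
      rw [hv, hv, hr, hr, hw, hw]
      exact (key k hk).2 (h k _ _ _)
    · intro h k _ _ h₂
      have hk := Nat.lt_of_succ_lt_succ h₂
      have h' := h k hk
      rw [hv, hv, hr, hr, hw, hw] at h'
      exact (key k hk).1 h'
  tfae_have 1 ↔ 3 := by
    rw [sys.dAction_eq_zero_iff]
    constructor
    · intro h ξ k hk
      exact (hsys.JSection_sub_eq_iff ξ _ _ _).2 (h k _ _ _ _ (ξ.mem _))
    · intro h k _ _ h₂ η hη
      -- Condition 3 only tests values of global sections, so the given `η` must be realised as one.
      obtain ⟨ξ, rfl⟩ := sys.exists_gDSection hS _ hη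
      exact (hsys.JSection_sub_eq_iff ξ _ _ _).1 (h ξ k (Nat.lt_of_succ_lt_succ h₂))
  tfae_finish
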